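/- Let $(V_i)_{i\ge 0}$ be i.i.d. real random variables and $(Y_i)_{i\ge 0}=(B_i-A_i)_{i\ge 0}$ i.i.d., the two sequences being independent of each other, where for each $i$ the variables $A_i,B_i\ge 0$ are independent, the $A_i$ are identically distributed, and so are the $B_i$. Let $W_0=w\ge 0$ and $W_{i+1}=\max(V_iW_i+Y_i,0)$. Assume that $\mathbb P(V_0=a)=p$ and $\mathbb P(V_0<0)=1-p$ with $a>0$ and $0<p<1$, and let $\nu$ be the conditional law of $V_0$ given $V_0<0$. Assume that for $\operatorname{Re} z\ge 0$ $$\mathbb E e^{-zB_0}=\frac{N_B(z)}{D_B(z)},\quad D_B(z)=\prod_{j=1}^{\ell}(z-s_j),\qquad \mathbb E e^{-zA_0}=\frac{N_A(z)}{D_A(z)},\quad D_A(z)=\prod_{i=1}^{m}(z-t_i),$$ where $\operatorname{Re}s_j<0$, $\operatorname{Re}t_i<0$ (poles are listed with multiplicity) and $N_B,N_A$ are polynomials of degree at most $\ell-1$ and $m-1$ that have no zero in common with $D_B$ and $D_A$, respectively. Put $$D_Y(z)=D_B(z)D_A(-z),\quad N_Y(z)=N_B(z)N_A(-z),\quad \Phi_Y=N_Y/D_Y,$$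 and, for $0<r<1$ and $\operatorname{Re}z\ge 0$, let $U(z)=\sum_{i\ge 0}r^i\,\mathbb E e^{-zW_i}$ and $E(z)=D_Y(z)-rp\,N_Y(z)$. Then for every $r\in(0,1)$ there are constants $a_0,\dots,a_{m+\ell}\in\mathbb C$ (depending on $r$), with $$a_0=\frac{r}{1-r}(1-p)(-1)^{\ell+m}\prod_{j=1}^{\ell}s_j\prod_{i=1}^{m}t_i ,$$ such that, writing $P(z)=\sum_{k=0}^{m+\ell}a_kz^k$, $$r(1-p)N_Y(s_j)\int U(s_jy)\,\nu(dy)=P(s_j),\qquad j=1,\dots,\ell, \tag{1}$$ and the following holds. **1. If $a=1$:** for $\operatorname{Re} z\ge 0$ with $E(z)\ne 0$, $$U(z)=\frac{D_Y(z)e^{-zw}+P(z)}{E(z)} .$$ The polynomial $E$ (whose zeros that are not zeros of $D_Y$ are the zeros of $1-rp\,\Phi_Y$) has exactly $m$ zeros $\delta_1,\dots,\delta_m$, counted with multiplicity, in $\operatorname{Re}z>0$, and $$\sum_{k=0}^{m+\ell}\delta_i^k a_k=-e^{-\delta_iw}D_Y(\delta_i),\qquad i=1,\dots,m .$$ For each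 $j$ for which $E(s_jy)\neq0$ for $\nu$-almost every $y$, equation (1) reads $$r(1-p)N_Y(s_j)\int \frac{D_Y(s_jy)e^{-s_jyw}+P(s_jy)}{E(s_jy)}\,\nu(dy)=P(s_j).$$ If moreover $y\mapsto 1/E(s_jy)$ is $\nu$-integrable and $N_Y(s_j)\ne0$, then the integrals below converge absolutely and $$\sum_{k=0}^{m+\ell}\Big(\frac{s_j^k}{r(1-p)N_Y(s_j)}-\int\frac{(s_jy)^k}{E(s_jy)}\,\nu(dy)\Big)a_k=\int\frac{D_Y(s_jy)\,e^{-s_jyw}}{E(s_jy)}\,\nu(dy).$$ **2. If $a\ne 1$:** for $\operatorname{Re} z\ge 0$ with $D_Y(a^hz)\ne0$ for all $h\ge 0$, $$U(z)=\sum_{h=0}^{\infty}\Big(e^{-a^hzw}+\frac{P(a^hz)}{D_Y(a^hz)}\Big)(rp)^h\prod_{n=0}^{h-1}\Phi_Y(a^nz),$$ the series being absolutely convergent. For $i=1,\dots,m$, $$-rp\,N_Y(-t_i)\,U(-at_i)=P(-t_i),$$ and if $D_Y(-a^{h+1}t_i)\neq 0$ for all $h\ge0$ then this equation reads (with convergent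 series) $$\sum_{k=0}^{m+\ell}(-t_i)^ka_k\Big(1+rp\,N_Y(-t_i)\sum_{h=0}^\infty\frac{a^{k(h+1)}(rp)^h\prod_{n=0}^{h-1}\Phi_Y(-a^{n+1}t_i)}{D_Y(-a^{h+1}t_i)}\Big)=-rp\,N_Y(-t_i)\sum_{h=0}^\infty e^{a^{h+1}t_iw}(rp)^h\prod_{n=0}^{h-1}\Phi_Y(-a^{n+1}t_i).$$ For each $j$ for which, for $\nu$-almost every $y$, $D_Y(a^hs_jy)\ne0$ for all $h\ge0$, equation (1) holds with $U(s_jy)$ replaced by the series above. If moreover, for every $k\le m+\ell$, the series of integrals in the definition of $d_k$ below converges absolutely (that is, the integrals of the absolute values are finite and have, with the factors $(rp)^h$, a finite sum), then so does the series on the right-hand side, and $$\sum_{k=0}^{m+\ell}d_k(s_j)\,a_k=r(1-p)N_Y(s_j)\sum_{h=0}^{\infty}(rp)^h\int e^{-a^hs_jyw}\prod_{n=0}^{h-1}\Phi_Y(a^ns_jy)\,\nu(dy),$$ $$d_k(s_j)=s_j^k\Big(1-r(1-p)N_Y(s_j)\sum_{h=0}^\infty(rp)^h\int\frac{(a^hy)^k\prod_{n=0}^{h-1}\Phi_Y(a^ns_jy)}{D_Y(a^hs_jy)}\,\nu(dy)\Big).$$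 -/

import Mathlib

open MeasureTheory ProbabilityTheory

namespace ReflectedRecursion

noncomputable section

/-- The Laplace-Stieltjes transform `E exp(-s X)` of a real random variable `X`. -/
def lst {Ω : Type*} [MeasurableSpace Ω] (μ : Measure Ω) (X : Ω → ℝ) (s : ℂ) : ℂ :=
  ∫ ω, Complex.exp (-s * (X ω : ℂ)) ∂μ

/-- The monic polynomial `∏ i, (z - s i)`, where the `s i` are listed with multiplicity. -/
def poleDen {n : ℕ} (s : Fin n → ℂ) : Polynomial ℂ :=
  ∏ i, (Polynomial.X - Polynomial.C (s i))

/-- `X` has the rational transform `N(z) / ∏ i, (z - s i)` on `Re z ≥ 0`, with `N` of degree at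
most `n - 1` and without common zeros with the denominator. -/
structure HasRationalLST {Ω : Type*} [MeasurableSpace Ω] (μ : Measure Ω) (X : Ω → ℝ)
    {n : ℕ} (s : Fin n → ℂ) (N : Polynomial ℂ) : Prop where
  degree_lt : N.degree < (n : WithBot ℕ)
  eval_ne_zero : ∀ i, N.eval (s i) ≠ 0
  lst_eq : ∀ z : ℂ, 0 ≤ z.re → lst μ X z = N.eval z / (poleDen s).eval z

/-- The process `W 0 = w`, `W (i + 1) = (V i * W i + Y i)⁺`. -/
def process {Ω : Type*} (V Y : ℕ → Ω → ℝ) (w : ℝ) : ℕ → Ω → ℝ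
  | 0 => fun _ => w
  | i + 1 => fun ω => max (V i ω * process V Y w i ω + Y i ω) 0

/-- The generating function `∑ i, r ^ i * E exp(-s W i)`. -/
def genLST {Ω : Type*} [MeasurableSpace Ω] (μ : Measure Ω) (W : ℕ → Ω → ℝ) (r : ℝ) (s : ℂ) : ℂ :=
  ∑' i : ℕ, (r : ℂ) ^ i * lst μ (W i) s

/-- The conditional law of `V` given `V < 0`. -/
def negLaw {Ω : Type*} [MeasurableSpace Ω] (μ : Measure Ω) (V : Ω → ℝ) : Measure ℝ :=
  (μ[|{ω | V ω < 0}]).map V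

/-- `D_Y(z) = D_B(z) D_A(-z)`, where `s` lists the poles for `B` and `t` those for `A`. -/
def denY {l m : ℕ} (s : Fin l → ℂ) (t : Fin m → ℂ) : Polynomial ℂ :=
  poleDen s * (poleDen t).comp (-Polynomial.X)

/-- `N_Y(z) = N_B(z) N_A(-z)`. -/
def numY (NB NA : Polynomial ℂ) : Polynomial ℂ :=
  NB * NA.comp (-Polynomial.X)

/-- The product `∏ j < h, Φ(a ^ j z)` with `Φ = N / D`. -/
def prodPhi (D N : Polynomial ℂ) (a : ℝ) (z : ℂ) (h : ℕ) : ℂ :=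
  ∏ j ∈ Finset.range h, N.eval ((a : ℂ) ^ j * z) / D.eval ((a : ℂ) ^ j * z)

/-- The polynomial function `∑ k, c k * z ^ k`. -/
def coefSum {n : ℕ} (c : Fin n → ℂ) (z : ℂ) : ℂ :=
  ∑ k, c k * z ^ (k : ℕ)

/-- The term with index `h` of the series for the case `a ≠ 1`; here `q` stands for `r p`. -/
def seriesTerm {n : ℕ} (D N : Polynomial ℂ) (a w q : ℝ) (c : Fin n → ℂ) (z : ℂ) (h : ℕ) : ℂ :=
  (Complex.exp (-((a : ℂ) ^ h * z) * (w : ℂ)) +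
      coefSum c ((a : ℂ) ^ h * z) / D.eval ((a : ℂ) ^ h * z)) *
    (q : ℂ) ^ h * prodPhi D N a z h

/-- Absolute convergence of `∑ h, ∫ f h dν`. -/
def AbsConvergent (ν : Measure ℝ) (f : ℕ → ℝ → ℂ) : Prop :=
  (∀ h, Integrable (f h) ν) ∧ Summable fun h => ∫ y, ‖f h y‖ ∂ν

end

end ReflectedRecursion

open ReflectedRecursion

/-! The proof is a Wiener–Hopf argument. On Re z = 0 one has e^{-z max(x,0)} = e^{-zx} + 1 - e^{-z
min(x,0)}. Take x = V_i W_i + Y_i. By independence (`indepFun_mul_process`) its transform is that of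
V_i W_i times Φ_Y, and splitting V_i according to its atom (`lst_mul_eq_add`) turns the first factor
into p E e^{-azW_i} plus a part carried by {V_i < 0}. Multiplying by D_Y and summing against r^i
gives an identity L = R on the imaginary axis, where L(z) = D_Y(z)(U(z) - e^{-zw}) - rp N_Y(z) U(az)
involves only transforms of nonnegative variables, and R = r N_Y S_G + D_Y (r/(1-r) - r S_M) only
transforms of nonpositive ones. Here S_G and S_M are the generating functions of the part on {V_i <
0} and of the negative part.

Thus L is holomorphic on the right, R on the left, and both are O((1+|z|)^{m+ℓ}). By Morera they
glue to an entire function, and by Cauchy's estimates that function is a polynomial P of degree at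
most m+ℓ (`exists_coefSum_of_halfPlanes`, `exists_coefSum_genLST`).

Everything else evaluates L = P or R = P. The point 0 gives a_0. At s_j the factor D_Y vanishes and
R = P becomes equation (1), after Fubini over the law of V_i on the negative axis. If a = 1, L = P
reads E U = D_Y e^{-zw} + P, so the right side vanishes at the zeros of E with Re z > 0; Rouché on
the half-plane (`card_roots_sub_right_halfPlane`) counts them. If a ≠ 1, L = P expresses U(z)
through U(az) and is iterated (`hasSum_seriesTerm`). The orbit a^h z tends to 0 or to infinity,
where Φ_Y tends to 1 or to 0, so the factor rp < 1 forces convergence; the zeros -t_i of D_Y give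
the further equations. -/

namespace ReflectedRecursion

/-! ### Gluing across the imaginary axis, and Liouville for polynomial growth -/

section EntireFunctions

open Complex Set Filter Topology

/-- A continuous function which is holomorphic off the imaginary axis is entire. -/
theorem differentiable_of_continuous_of_re_ne_zero {f : ℂ → ℂ} (hc : Continuous f)
    (hd : ∀ z : ℂ, z.re ≠ 0 → DifferentiableAt ℂ f z) : Differentiable ℂ f := by
  -- Morera: the rectangle is cut along the imaginary axis, so that the interior of each piece
  -- avoids the axis. When both corners lie on one side, the two pieces overlap, and the signed
  -- interval integrals still add up.
  have hcons : IsConservativeOn f univ := by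
    intro z w _
    rw [← add_eq_zero_iff_eq_neg, wedgeIntegral_add_wedgeIntegral_eq]
    have h1 := integral_boundary_rect_eq_zero_of_continuousOn_of_differentiableOn f z ⟨0, w.im⟩
      hc.continuousOn (fun x hx => (hd x (by
        have hx1 := hx.1
        simp only [mem_preimage, mem_Ioo, min_lt_iff, lt_max_iff] at hx1
        intro h; rw [h] at hx1; grind)).differentiableWithinAt)
    have h2 := integral_boundary_rect_eq_zero_of_continuousOn_of_differentiableOn f ⟨0, z.im⟩ w
      hc.continuousOn (fun x hx => (hd x (by
        have hx1 := hx.1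
        simp only [mem_preimage, mem_Ioo, min_lt_iff, lt_max_iff] at hx1
        intro h; rw [h] at hx1; grind)).differentiableWithinAt)
    have hi : ∀ y a b : ℝ, IntervalIntegrable (fun x : ℝ => f (x + y * I)) volume a b :=
      fun y a b => (by fun_prop : Continuous fun x : ℝ => f (x + y * I)).intervalIntegrable a b
    have h3 := intervalIntegral.integral_add_adjacent_intervals (hi z.im z.re 0) (hi z.im 0 w.re)
    have h4 := intervalIntegral.integral_add_adjacent_intervals (hi w.im z.re 0) (hi w.im 0 w.re)
    rw [← h3, ← h4]
    simp only at h1 h2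
    linear_combination (norm := (simp only [smul_eq_mul]; ring)) h1 + h2
  have := (hcons.isExactOn_univ hc).differentiableOn isOpen_univ
  exact differentiableOn_univ.mp this

/-- An entire function of polynomial growth is a polynomial. -/
theorem exists_coefSum_of_growth {f : ℂ → ℂ} (hf : Differentiable ℂ f) {C : ℝ} {n : ℕ}
    (hb : ∀ z, ‖f z‖ ≤ C * (1 + ‖z‖) ^ n) :
    ∃ c : Fin (n + 1) → ℂ, ∀ z, f z = coefSum c z := by
  -- Cauchy's estimate on the circle of radius R gives the bound k! C (1+R)^n / R^k, which tends to
  -- 0 as R grows.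
  have hz : ∀ k, n < k → iteratedDeriv k f 0 = 0 := by
    intro k hk
    have hlim : Tendsto (fun R : ℝ => k.factorial * (C * (1 + R) ^ n) / R ^ k) atTop (𝓝 0) := by
      have h1 : Tendsto (fun R : ℝ => (k.factorial * C * ((R⁻¹ + 1) ^ n)) * (R⁻¹) ^ (k - n)) atTop
          (𝓝 ((k.factorial * C * ((0 + 1) ^ n)) * 0 ^ (k - n))) :=
        ((((tendsto_inv_atTop_zero).add_const 1).pow n).const_mul _).mul
          ((tendsto_inv_atTop_zero).pow _)
      rw [zero_pow (by omega), mul_zero] at h1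
      refine h1.congr' ?_
      filter_upwards [eventually_gt_atTop 0] with R hR
      obtain ⟨d, rfl⟩ : ∃ d, k = n + d := ⟨k - n, by omega⟩
      rw [Nat.add_sub_cancel_left]
      have : R⁻¹ + 1 = (1 + R) / R := by field_simp
      rw [this, div_pow, inv_pow, pow_add]
      field_simp
    have : ‖iteratedDeriv k f 0‖ ≤ 0 := by
      refine ge_of_tendsto hlim ?_
      filter_upwards [eventually_gt_atTop 0] with R hR
      refine norm_iteratedDeriv_le_of_forall_mem_sphere_norm_le k hR hf.diffContOnCl ?_
      intro z hz
      rw [mem_sphere_zero_iff_norm] at hz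
      simpa [hz] using hb z
    simpa using this
  refine ⟨fun k => ((k : ℕ).factorial : ℂ)⁻¹ * iteratedDeriv k f 0, fun z => ?_⟩
  have h := taylorSeries_eq_of_entire' 0 z hf
  rw [← h, tsum_eq_sum (s := Finset.range (n + 1)), coefSum, Finset.sum_range]
  · simp
  · intro k hk
    rw [hz k (by simpa using hk)]; simp

/-- Two functions, holomorphic in the right and in the left half-plane, which agree on the
imaginary axis and grow polynomially are the same polynomial. -/
theorem exists_coefSum_of_halfPlanes {L R : ℂ → ℂ}
    (hLc : ContinuousOn L {z | 0 ≤ z.re}) (hLd : DifferentiableOn ℂ L {z | 0 < z.re})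
    (hRc : ContinuousOn R {z | z.re ≤ 0}) (hRd : DifferentiableOn ℂ R {z | z.re < 0})
    (heq : ∀ z : ℂ, z.re = 0 → L z = R z) {C : ℝ} {n : ℕ}
    (hLb : ∀ z : ℂ, 0 ≤ z.re → ‖L z‖ ≤ C * (1 + ‖z‖) ^ n)
    (hRb : ∀ z : ℂ, z.re ≤ 0 → ‖R z‖ ≤ C * (1 + ‖z‖) ^ n) :
    ∃ c : Fin (n + 1) → ℂ, (∀ z : ℂ, 0 ≤ z.re → L z = coefSum c z) ∧
      ∀ z : ℂ, z.re ≤ 0 → R z = coefSum c z := by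
  classical
  let f : ℂ → ℂ := fun z => if 0 ≤ z.re then L z else R z
  have hfL : ∀ z : ℂ, 0 ≤ z.re → f z = L z := fun z hz => if_pos hz
  have hfR : ∀ z : ℂ, z.re ≤ 0 → f z = R z := by
    intro z hz
    rcases hz.eq_or_lt with h | h
    · rw [hfL z h.ge, heq z h]
    · exact if_neg (not_le.mpr h)
  have hfc : Continuous f := by
    rw [← continuousOn_univ]
    have hu : (univ : Set ℂ) = {z | 0 ≤ z.re} ∪ {z | z.re ≤ 0} := by
      ext z; simpa using le_total _ _
    rw [hu]
    exact (hLc.congr fun z hz => hfL z hz).union_of_isClosed (hRc.congr fun z hz => hfR z hz)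
      (isClosed_le continuous_const continuous_re) (isClosed_le continuous_re continuous_const)
  have hfd : Differentiable ℂ f := by
    refine differentiable_of_continuous_of_re_ne_zero hfc fun z hz => ?_
    rcases lt_or_gt_of_ne hz with h | h
    · exact (hRd.congr fun z hz => hfR z (le_of_lt hz)).differentiableAt
        ((isOpen_lt continuous_re continuous_const).mem_nhds h)
    · exact (hLd.congr fun z hz => hfL z (le_of_lt hz)).differentiableAt
        ((isOpen_lt continuous_const continuous_re).mem_nhds h)
  obtain ⟨c, hcs⟩ := exists_coefSum_of_growth hfd (C := C) (n := n) fun z => by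
    rcases le_total 0 z.re with h | h
    · rw [hfL z h]; exact hLb z h
    · rw [hfR z h]; exact hRb z h
  exact ⟨c, fun z hz => by rw [← hcs, hfL z hz], fun z hz => by rw [← hcs, hfR z hz]⟩

end EntireFunctions

/-! ### Counting zeros in a half-plane by the argument along its boundary -/

section RootCounting

open Complex Set Filter Topology

/-- The sum over `ρ ∈ S` of the change of argument of `z - ρ` along the imaginary axis, up to
sign and constants. -/
noncomputable def argSum (S : Multiset ℂ) (y : ℝ) : ℝ :=
  (S.map fun ρ => Real.arctan ((y - ρ.im) / ρ.re)).sum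

/-- Each arctangent has derivative Re ρ / |iy - ρ|² = -Re (1/(iy - ρ)). When S lists the roots of Q,
the sum of the 1/(iy - ρ) is the logarithmic derivative Q'/Q at iy. -/
theorem hasDerivAt_argSum {S : Multiset ℂ} (hS : ∀ ρ ∈ S, ρ.re ≠ 0) (y : ℝ) :
    HasDerivAt (argSum S) (-((S.map fun ρ => 1 / (y * I - ρ)).sum).re) y := by
  induction S using Multiset.induction with
  | empty => simpa [argSum] using! hasDerivAt_const y (0 : ℝ)
  | cons ρ S ih =>
    have h1 := ih fun σ hσ => hS σ (Multiset.mem_cons_of_mem hσ)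
    have hρ := hS ρ (Multiset.mem_cons_self _ _)
    have h2 : HasDerivAt (fun y : ℝ => Real.arctan ((y - ρ.im) / ρ.re))
        (-(1 / (y * I - ρ) : ℂ).re) y := by
      have h := (((hasDerivAt_id y).sub_const ρ.im).div_const ρ.re).arctan
      refine h.congr_deriv ?_
      have h3 : normSq (y * I - ρ) = ρ.re ^ 2 + (y - ρ.im) ^ 2 := by
        rw [normSq_apply]; simp; ring
      rw [one_div (y * I - ρ : ℂ), inv_re, h3]
      have : ρ.re ^ 2 + (y - ρ.im) ^ 2 ≠ 0 := by positivity
      simp only [id, sub_re, mul_re, ofReal_re, I_re, mul_zero, ofReal_im, I_im, zero_mul, sub_self,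
        zero_sub]
      field_simp
    have h3 := h2.add h1
    have e : argSum (ρ ::ₘ S) = (fun y : ℝ => Real.arctan ((y - ρ.im) / ρ.re)) + argSum S := by
      ext x; simp [argSum]
    rw [e]
    refine h3.congr_deriv ?_
    simp only [Multiset.map_cons, Multiset.sum_cons, add_re]; ring

/-- A point to the right of the axis contributes ±π/2 at ±∞, a point to the left ∓π/2. The limits
therefore record how many more points lie on the right than on the left. -/
theorem tendsto_argSum {S : Multiset ℂ} (hS : ∀ ρ ∈ S, ρ.re ≠ 0) :
    Tendsto (argSum S) atTop (𝓝 (Real.pi / 2 *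
      ((S.filter fun ρ => 0 < ρ.re).card - (S.filter fun ρ => ¬ 0 < ρ.re).card))) ∧
    Tendsto (argSum S) atBot (𝓝 (-(Real.pi / 2 *
      ((S.filter fun ρ => 0 < ρ.re).card - (S.filter fun ρ => ¬ 0 < ρ.re).card)))) := by
  induction S using Multiset.induction with
  | empty =>
    have : argSum 0 = fun _ => 0 := by ext; simp [argSum]
    simp [this]
  | cons ρ S ih =>
    obtain ⟨h1, h2⟩ := ih fun σ hσ => hS σ (Multiset.mem_cons_of_mem hσ)
    have hρ := hS ρ (Multiset.mem_cons_self _ _)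
    have e : argSum (ρ ::ₘ S) = fun y : ℝ => Real.arctan ((y - ρ.im) / ρ.re) + argSum S y := by
      ext x; simp [argSum]
    have t1 := tendsto_nhds_of_tendsto_nhdsWithin Real.tendsto_arctan_atTop
    have t2 := tendsto_nhds_of_tendsto_nhdsWithin Real.tendsto_arctan_atBot
    have u1 : Tendsto (fun y : ℝ => y - ρ.im) atTop atTop :=
      tendsto_atTop_add_const_right _ _ tendsto_id
    have u2 : Tendsto (fun y : ℝ => y - ρ.im) atBot atBot :=
      tendsto_atBot_add_const_right _ _ tendsto_id
    rw [e]
    rcases lt_or_gt_of_ne hρ with h | h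
    · have hn : ¬ 0 < ρ.re := not_lt.mpr h.le
      rw [Multiset.filter_cons_of_neg S (p := fun ρ : ℂ => 0 < ρ.re) hn,
        Multiset.filter_cons_of_pos S (p := fun ρ : ℂ => ¬ 0 < ρ.re) hn, Multiset.card_cons]
      constructor
      · have h3 := (t2.comp (u1.atTop_mul_const_of_neg (inv_neg''.mpr h))).add h1
        refine (h3.congr fun y => ?_).trans (le_of_eq (congrArg 𝓝 ?_))
        · simp [div_eq_mul_inv]
        · push_cast; ring
      · have h3 := (t1.comp (u2.atBot_mul_const_of_neg (inv_neg''.mpr h))).add h2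
        refine (h3.congr fun y => ?_).trans (le_of_eq (congrArg 𝓝 ?_))
        · simp [div_eq_mul_inv]
        · push_cast; ring
    · rw [Multiset.filter_cons_of_pos S (p := fun ρ : ℂ => 0 < ρ.re) h,
        Multiset.filter_cons_of_neg S (p := fun ρ : ℂ => ¬ 0 < ρ.re) (not_not.mpr h),
        Multiset.card_cons]
      constructor
      · have h3 := (t1.comp (u1.atTop_mul_const (inv_pos.mpr h))).add h1
        refine (h3.congr fun y => ?_).trans (le_of_eq (congrArg 𝓝 ?_))
        · simp [div_eq_mul_inv]
        · push_cast; ring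
      · have h3 := (t2.comp (u2.atBot_mul_const (inv_pos.mpr h))).add h2
        refine (h3.congr fun y => ?_).trans (le_of_eq (congrArg 𝓝 ?_))
        · simp [div_eq_mul_inv]
        · push_cast; ring

theorem tendsto_ofReal_mul_I_cobounded_atTop :
    Tendsto (fun y : ℝ => (y * I : ℂ)) atTop (Bornology.cobounded ℂ) := by
  rw [← tendsto_norm_atTop_iff_cobounded]
  simpa using tendsto_abs_atTop_atTop

theorem tendsto_ofReal_mul_I_cobounded_atBot :
    Tendsto (fun y : ℝ => (y * I : ℂ)) atBot (Bornology.cobounded ℂ) := by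
  rw [← tendsto_norm_atTop_iff_cobounded]
  simpa using tendsto_abs_atBot_atTop

theorem eval_ne_zero_of_norm_lt {D M : Polynomial ℂ} {z : ℂ} (h : ‖M.eval z‖ < ‖D.eval z‖) :
    (D - M).eval z ≠ 0 := by
  rw [Polynomial.eval_sub, sub_ne_zero]
  intro h'
  rw [h'] at h
  exact lt_irrefl _ h

/-- **Rouché's theorem** for polynomials in the right half-plane. -/
theorem card_roots_sub_right_halfPlane {D M : Polynomial ℂ} (hdeg : M.degree < D.degree)
    (hlt : ∀ y : ℝ, ‖M.eval (y * I)‖ < ‖D.eval (y * I)‖) :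
    ((D - M).roots.filter fun z => 0 < z.re).card = (D.roots.filter fun z => 0 < z.re).card := by
  have hD0 : ∀ y : ℝ, D.eval (y * I) ≠ 0 := fun y h => by
    have := hlt y; rw [h, norm_zero] at this; exact absurd this (not_lt.mpr (norm_nonneg _))
  have hE0 : ∀ y : ℝ, (D - M).eval (y * I) ≠ 0 := fun y => eval_ne_zero_of_norm_lt (hlt y)
  have hre : ∀ {Q : Polynomial ℂ}, (∀ y : ℝ, Q.eval (y * I) ≠ 0) → ∀ ρ ∈ Q.roots, ρ.re ≠ 0 := by
    intro Q hQ ρ hρ h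
    apply hQ ρ.im
    have : (ρ.im * I : ℂ) = ρ := by apply Complex.ext <;> simp [h]
    rw [this]
    exact (Polynomial.mem_roots'.mp hρ).2
  have hcardeq : (D - M).roots.card = D.roots.card := by
    rw [← (IsAlgClosed.splits _).natDegree_eq_card_roots,
      ← (IsAlgClosed.splits _).natDegree_eq_card_roots]
    exact Polynomial.natDegree_eq_of_degree_eq (Polynomial.degree_sub_eq_left_of_degree_lt hdeg)
  -- Z = 1 - M/D stays in the open unit disc around 1, so the principal logarithm is smooth along
  -- the whole axis and no winding can occur.
  let Z : ℝ → ℂ := fun y => (D - M).eval (y * I) / D.eval (y * I)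
  have hZ1 : ∀ y, Z y = 1 - M.eval (y * I) / D.eval (y * I) := by
    intro y
    simp only [Z, Polynomial.eval_sub, sub_div, div_self (hD0 y)]
  have hZs : ∀ y, Z y ∈ slitPlane := by
    intro y
    rw [hZ1]
    left
    have : ‖M.eval (y * I) / D.eval (y * I)‖ < 1 := by
      rw [norm_div, div_lt_one (norm_pos_iff.mpr (hD0 y))]
      exact hlt y
    have h2 := (re_le_norm _).trans_lt this
    simp only [sub_re, one_re]; linarith
  have hder : ∀ (Q : Polynomial ℂ) (y : ℝ),
      HasDerivAt (fun y : ℝ => Q.eval (y * I)) (Q.derivative.eval (y * I) * I) y := by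
    intro Q y
    have h1 : HasDerivAt (fun y : ℝ => (y * I : ℂ)) I y := by
      simpa using (hasDerivAt_id y).ofReal_comp.mul_const I
    exact (Q.hasDerivAt (y * I)).comp y h1
  have hlog : ∀ y : ℝ, HasDerivAt (fun y : ℝ => (log (Z y)).im)
      (((D - M).roots.map fun ρ => 1 / (y * I - ρ)).sum.re -
        (D.roots.map fun ρ => 1 / (y * I - ρ)).sum.re) y := by
    intro y
    have h1 := ((hder (D - M) y).div (hder D y) (hD0 y)).clog_real (hZs y)
    have h2 := (imCLM.hasFDerivAt (x := log (Z y))).comp_hasDerivAt y h1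
    refine h2.congr_deriv ?_
    rw [← (IsAlgClosed.splits (D - M)).eval_derivative_div_eval_of_ne_zero (hE0 y),
      ← (IsAlgClosed.splits D).eval_derivative_div_eval_of_ne_zero (hD0 y), ← sub_re, imCLM_apply]
    have e : ((D - M).derivative.eval (y * I) * I * D.eval (y * I) -
        (D - M).eval (y * I) * (D.derivative.eval (y * I) * I)) / D.eval (y * I) ^ 2 /
          ((D - M).eval (y * I) / D.eval (y * I)) =
        I * ((D - M).derivative.eval (y * I) / (D - M).eval (y * I) -
          D.derivative.eval (y * I) / D.eval (y * I)) := by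
      have hd := hD0 y
      have he := hE0 y
      generalize (D - M).eval (y * I) = u at he ⊢
      field_simp
    simp only [Pi.div_apply]
    rw [e, I_mul_im]
  -- Both Im log Z and the difference of the two `argSum`s follow the argument of (D - M)/D, with
  -- opposite signs; their sum is constant.
  let K : ℝ → ℝ := fun y => (log (Z y)).im + argSum (D - M).roots y - argSum D.roots y
  have hK : ∀ y, HasDerivAt K 0 y := by
    intro y
    refine (((hlog y).add (hasDerivAt_argSum (hre hE0) y)).sub
      (hasDerivAt_argSum (hre hD0) y)).congr_deriv ?_
    ring
  have hconst : ∀ y, K y = K 0 := fun y =>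
    is_const_of_deriv_eq_zero (fun y => (hK y).differentiableAt) (fun y => (hK y).deriv) y 0
  have hlim : ∀ l : Filter ℝ, Tendsto (fun y : ℝ => (y * I : ℂ)) l (Bornology.cobounded ℂ) →
      Tendsto (fun y => (log (Z y)).im) l (𝓝 0) := by
    intro l hl
    have h1 : Tendsto Z l (𝓝 1) := by
      have := ((Polynomial.isLittleO_cobounded_of_degree_lt hdeg).tendsto_div_nhds_zero.comp
        hl).const_sub 1
      rw [sub_zero] at this
      exact this.congr fun y => (hZ1 y).symm
    have h2 := (continuous_im.tendsto _).comp (h1.clog (by simp))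
    rw [log_one, zero_im] at h2
    exact h2
  obtain ⟨eT, eB⟩ := tendsto_argSum (hre hE0)
  obtain ⟨dT, dB⟩ := tendsto_argSum (hre hD0)
  -- Since M/D tends to 0 at both ends, the constant K equals both (π/2)Δ and -(π/2)Δ, where Δ
  -- compares "zeros on the right minus zeros on the left" for D - M and for D. Hence Δ = 0; as the
  -- total numbers of zeros agree, so do the numbers on the right.
  have kT := ((hlim _ tendsto_ofReal_mul_I_cobounded_atTop).add eT).sub dT
  have kB := ((hlim _ tendsto_ofReal_mul_I_cobounded_atBot).add eB).sub dB
  have hT := tendsto_nhds_unique (tendsto_const_nhds.congr fun y => (hconst y).symm) kT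
  have hB := tendsto_nhds_unique (tendsto_const_nhds.congr fun y => (hconst y).symm) kB
  have s1 := congrArg Multiset.card
    (Multiset.filter_add_not (fun z : ℂ => 0 < z.re) (D - M).roots)
  have s2 := congrArg Multiset.card (Multiset.filter_add_not (fun z : ℂ => 0 < z.re) D.roots)
  rw [Multiset.card_add] at s1 s2
  rw [hcardeq] at s1
  rw [hT] at hB
  have s1' : (((D - M).roots.filter fun z => 0 < z.re).card : ℝ) +
      ((D - M).roots.filter fun z => ¬ 0 < z.re).card = D.roots.card := by exact_mod_cast s1
  have s2' : ((D.roots.filter fun z => 0 < z.re).card : ℝ) +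
      (D.roots.filter fun z => ¬ 0 < z.re).card = D.roots.card := by exact_mod_cast s2
  have hpi := Real.pi_pos
  have : Real.pi * ((((D - M).roots.filter fun z => 0 < z.re).card : ℝ) -
      (D.roots.filter fun z => 0 < z.re).card) = 0 := by
    have h1 : ((D - M).roots.filter fun z => ¬ 0 < z.re).card =
      (D.roots.card : ℝ) - ((D - M).roots.filter fun z => 0 < z.re).card := by linarith
    have h2 : (D.roots.filter fun z => ¬ 0 < z.re).card =
      (D.roots.card : ℝ) - (D.roots.filter fun z => 0 < z.re).card := by linarith
    rw [h1, h2] at hB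
    linear_combination hB / 2
  have h := (mul_eq_zero.mp this).resolve_left hpi.ne'
  exact_mod_cast sub_eq_zero.mp h

end RootCounting

section IndependenceAndTransforms

open Complex Set Filter Topology

/-! ### Independence of the current state from the next input -/

section Independence

/-- The recursion is causal. Two sample spaces are allowed so that the state can be realised as a
function on the space of past inputs. -/
theorem process_congr {Ω Ω' : Type*} {V Y : ℕ → Ω → ℝ} {V' Y' : ℕ → Ω' → ℝ} {w : ℝ} {ω : Ω} {ω' : Ω'}
    (i : ℕ) (hV : ∀ j < i, V j ω = V' j ω') (hY : ∀ j < i, Y j ω = Y' j ω') :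
    process V Y w i ω = process V' Y' w i ω' := by
  induction i with
  | zero => rfl
  | succ i ih =>
    simp only [process]
    rw [hV i i.lt_succ_self, hY i i.lt_succ_self,
      ih (fun j hj => hV j (hj.trans i.lt_succ_self)) fun j hj => hY j (hj.trans i.lt_succ_self)]

theorem process_nonneg {Ω : Type*} {V Y : ℕ → Ω → ℝ} {w : ℝ} (hw : 0 ≤ w) (i : ℕ) (ω : Ω) :
    0 ≤ process V Y w i ω := by
  cases i with
  | zero => exact hw
  | succ i => exact le_max_right _ _

theorem comap_prod_eq_generateFrom {Ω α β : Type*} [MeasurableSpace α] [MeasurableSpace β]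
    (f : Ω → α × β) : MeasurableSpace.comap f inferInstance = MeasurableSpace.generateFrom
      (preimage f '' image2 (· ×ˢ ·) {s : Set α | MeasurableSet s} {t : Set β | MeasurableSet t}) := by
  rw [← MeasurableSpace.comap_generateFrom, generateFrom_prod]

variable {Ω : Type*} [MeasurableSpace Ω] {μ : Measure Ω}

/-- The hypotheses make the probability of any four-fold rectangle factor completely, so the
variables may be regrouped by index. Rectangles form a generating π-system, which suffices. -/
theorem indepFun_prodMk_prodMk_swap [IsProbabilityMeasure μ] {α₁ α₂ β₁ β₂ : Type*}
    [MeasurableSpace α₁] [MeasurableSpace α₂] [MeasurableSpace β₁] [MeasurableSpace β₂]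
    {X₁ : Ω → α₁} {X₂ : Ω → α₂} {Y₁ : Ω → β₁} {Y₂ : Ω → β₂}
    (hX₁ : Measurable X₁) (hX₂ : Measurable X₂) (hY₁ : Measurable Y₁) (hY₂ : Measurable Y₂)
    (hX : IndepFun X₁ X₂ μ) (hY : IndepFun Y₁ Y₂ μ)
    (hXY : IndepFun (fun ω => (X₁ ω, X₂ ω)) (fun ω => (Y₁ ω, Y₂ ω)) μ) :
    IndepFun (fun ω => (X₁ ω, Y₁ ω)) (fun ω => (X₂ ω, Y₂ ω)) μ := by
  rw [IndepFun_iff_Indep]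
  refine IndepSets.indep (hX₁.prodMk hY₁).comap_le (hX₂.prodMk hY₂).comap_le (isPiSystem_prod.comap _)
    (isPiSystem_prod.comap _) (comap_prod_eq_generateFrom _) (comap_prod_eq_generateFrom _) ?_
  rw [IndepSets_iff]
  rintro _ _ ⟨_, ⟨s₁, hs₁, t₁, ht₁, rfl⟩, rfl⟩ ⟨_, ⟨s₂, hs₂, t₂, ht₂, rfl⟩, rfl⟩
  have h1 := hXY.measure_inter_preimage_eq_mul (s₁ ×ˢ s₂) (t₁ ×ˢ t₂) (hs₁.prod hs₂) (ht₁.prod ht₂)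
  have h2 := hX.measure_inter_preimage_eq_mul s₁ s₂ hs₁ hs₂
  have h3 := hY.measure_inter_preimage_eq_mul t₁ t₂ ht₁ ht₂
  have h4 := (hXY.comp measurable_fst measurable_fst).measure_inter_preimage_eq_mul s₁ t₁ hs₁ ht₁
  have h5 := (hXY.comp measurable_snd measurable_snd).measure_inter_preimage_eq_mul s₂ t₂ hs₂ ht₂
  simp only [mk_preimage_prod] at h1 ⊢
  have e : X₁ ⁻¹' s₁ ∩ Y₁ ⁻¹' t₁ ∩ (X₂ ⁻¹' s₂ ∩ Y₂ ⁻¹' t₂) =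
      X₁ ⁻¹' s₁ ∩ X₂ ⁻¹' s₂ ∩ (Y₁ ⁻¹' t₁ ∩ Y₂ ⁻¹' t₂) := by
    ext; simp only [mem_inter_iff]; tauto
  rw [e, h1, h2, h3]
  change μ (X₁ ⁻¹' s₁ ∩ Y₁ ⁻¹' t₁) = μ (X₁ ⁻¹' s₁) * μ (Y₁ ⁻¹' t₁) at h4
  change μ (X₂ ⁻¹' s₂ ∩ Y₂ ⁻¹' t₂) = μ (X₂ ⁻¹' s₂) * μ (Y₂ ⁻¹' t₂) at h5
  rw [h4, h5]
  ring

theorem measurable_process {V Y : ℕ → Ω → ℝ} (hV : ∀ i, Measurable (V i))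
    (hY : ∀ i, Measurable (Y i)) (w : ℝ) (i : ℕ) : Measurable (process V Y w i) := by
  induction i with
  | zero => exact measurable_const
  | succ i ih => exact (((hV i).mul ih).add (hY i)).max measurable_const

/-- The state of the process is independent of the pair of variables driving the next step. -/
theorem indepFun_process [IsProbabilityMeasure μ] {V Y : ℕ → Ω → ℝ} (hV : ∀ i, Measurable (V i))
    (hY : ∀ i, Measurable (Y i)) (hVi : iIndepFun V μ) (hYi : iIndepFun Y μ)
    (hVY : IndepFun (fun ω i => V i ω) (fun ω i => Y i ω) μ) (w : ℝ) (i : ℕ) :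
    IndepFun (process V Y w i) (fun ω => (V i ω, Y i ω)) μ := by
  let past : (ℕ → Ω → ℝ) → Ω → (Finset.range i → ℝ) := fun Z ω j => Z j ω
  have hpast : ∀ {Z : ℕ → Ω → ℝ}, (∀ i, Measurable (Z i)) → Measurable (past Z) := fun hZ =>
    measurable_pi_lambda _ fun j => hZ j
  have hself : ∀ {Z : ℕ → Ω → ℝ}, (∀ i, Measurable (Z i)) → iIndepFun Z μ →
      IndepFun (past Z) (Z i) μ := by
    intro Z hZ hZi
    have h := hZi.indepFun_finset (Finset.range i) {i} (by simp) hZ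
    exact h.comp measurable_id
      (measurable_pi_apply (⟨i, Finset.mem_singleton_self i⟩ : ({i} : Finset ℕ)))
  have hrest : Measurable fun v : ℕ → ℝ => ((fun j : Finset.range i => v j), v i) := by fun_prop
  have h := indepFun_prodMk_prodMk_swap (hpast hV) (hV i) (hpast hY) (hY i) (hself hV hVi)
    (hself hY hYi) (hVY.comp hrest hrest)
  -- The default 0 is immaterial: the state at time i reads only inputs with index below i.
  let ext : (Finset.range i → ℝ) → ℕ → ℝ := fun v j =>
    if hj : j ∈ Finset.range i then v ⟨j, hj⟩ else 0
  have hext : ∀ j, Measurable fun v => ext v j := by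
    intro j
    by_cases hj : j ∈ Finset.range i
    · simp only [ext, hj, dif_pos]; fun_prop
    · simp only [ext, hj, dif_neg, not_false_eq_true]; fun_prop
  let G : (Finset.range i → ℝ) × (Finset.range i → ℝ) → ℝ :=
    process (fun j v => ext v.1 j) (fun j v => ext v.2 j) w i
  have hG : Measurable G := measurable_process (fun j => (hext j).comp measurable_fst)
    (fun j => (hext j).comp measurable_snd) w i
  have e : process V Y w i = G ∘ fun ω => (past V ω, past Y ω) := by
    ext ω
    refine process_congr i (fun j hj => ?_) fun j hj => ?_ <;>
    simp [ext, past, hj]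
  rw [e]
  exact h.comp hG measurable_id

/-- This is the independence that factors the transform of V_i W_i + Y_i. The regrouping lemma is
applied with a constant as its fourth variable. -/
theorem indepFun_mul_process [IsProbabilityMeasure μ] {V Y : ℕ → Ω → ℝ}
    (hV : ∀ i, Measurable (V i)) (hY : ∀ i, Measurable (Y i)) (hVi : iIndepFun V μ)
    (hYi : iIndepFun Y μ) (hVY : IndepFun (fun ω i => V i ω) (fun ω i => Y i ω) μ) (w : ℝ) (i : ℕ) :
    IndepFun (fun ω => V i ω * process V Y w i ω) (Y i) μ := by
  have h1 := indepFun_process hV hY hVi hYi hVY w i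
  have hW := measurable_process hV hY w i
  have h2 : IndepFun (V i) (Y i) μ := hVY.comp (measurable_pi_apply i) (measurable_pi_apply i)
  have h := indepFun_prodMk_prodMk_swap (X₂ := fun _ : Ω => ()) hW measurable_const (hV i) (hY i)
    (indepFun_const_right _ ()) h2 (h1.comp (φ := fun x => (x, ())) (by fun_prop) measurable_id)
  exact h.comp (φ := fun x : ℝ × ℝ => x.2 * x.1) (by fun_prop) measurable_snd

end Independence

/-! ### Laplace–Stieltjes transforms on closed half-planes -/

section Transform

variable {Ω : Type*} [MeasurableSpace Ω] {μ : Measure Ω}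

theorem norm_exp_neg_mul_ofReal_le_one {z : ℂ} {x : ℝ} (h : 0 ≤ z.re * x) :
    ‖exp (-z * x)‖ ≤ 1 := by
  rw [norm_exp, Real.exp_le_one_iff]
  simpa using h

theorem integrable_exp_neg_mul [IsFiniteMeasure μ] {X : Ω → ℝ} (hX : Measurable X) {z : ℂ}
    (h : ∀ᵐ ω ∂μ, 0 ≤ z.re * X ω) : Integrable (fun ω => exp (-z * X ω)) μ := by
  refine Integrable.of_bound (by fun_prop) 1 ?_
  filter_upwards [h] with ω hω using norm_exp_neg_mul_ofReal_le_one hω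

/-- Mass at most one, rather than exactly one, allows the use on the restriction of μ to {V_i < 0}.
-/
theorem norm_lst_le [IsFiniteMeasure μ] (hμ : μ.real univ ≤ 1) {X : Ω → ℝ} {z : ℂ}
    (h : ∀ᵐ ω ∂μ, 0 ≤ z.re * X ω) : ‖lst μ X z‖ ≤ 1 := by
  have := norm_integral_le_of_norm_le_const (μ := μ) (f := fun ω => exp (-z * X ω)) (C := 1)
    (by filter_upwards [h] with ω hω using norm_exp_neg_mul_ofReal_le_one hω)
  unfold lst
  linarith

theorem lst_neg (X : Ω → ℝ) (z : ℂ) : lst μ (fun ω => -X ω) z = lst μ X (-z) := by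
  simp [lst]

theorem lst_zero [IsProbabilityMeasure μ] (X : Ω → ℝ) : lst μ X 0 = 1 := by simp [lst]

theorem continuousOn_lst [IsFiniteMeasure μ] {X : Ω → ℝ} (hX : Measurable X)
    (h : ∀ᵐ ω ∂μ, 0 ≤ X ω) : ContinuousOn (lst μ X) {z | 0 ≤ z.re} := by
  refine continuousOn_of_dominated (bound := fun _ => 1) (fun z _ => by fun_prop) (fun z hz => ?_)
    (integrable_const _) (ae_of_all _ fun ω => by fun_prop)
  filter_upwards [h] with ω hω using norm_exp_neg_mul_ofReal_le_one (mul_nonneg hz hω)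

theorem differentiableOn_lst [IsFiniteMeasure μ] {X : Ω → ℝ} (hX : Measurable X)
    (h : ∀ᵐ ω ∂μ, 0 ≤ X ω) : DifferentiableOn ℂ (lst μ X) {z | 0 < z.re} := by
  -- The transform is the complex moment generating function at -z, which is holomorphic where the
  -- real part is interior to the set of integrable exponents.
  have hsub : Iio 0 ⊆ interior (integrableExpSet X μ) := by
    refine interior_maximal (fun t ht => ?_) isOpen_Iio
    refine Integrable.of_bound (by fun_prop) 1 ?_
    filter_upwards [h] with ω hω
    rw [Real.norm_eq_abs, Real.abs_exp, Real.exp_le_one_iff]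
    exact mul_nonpos_of_nonpos_of_nonneg (le_of_lt ht) hω
  have e : lst μ X = fun z => complexMGF X μ (-z) := rfl
  rw [e]
  refine differentiableOn_complexMGF.comp differentiableOn_id.neg fun z hz => hsub ?_
  simpa using hz

theorem lst_congr_identDistrib {X Y : Ω → ℝ} (h : IdentDistrib X Y μ μ) (z : ℂ) :
    lst μ X z = lst μ Y z :=
  (h.comp (u := fun x : ℝ => exp (-z * x)) (by fun_prop)).integral_eq

theorem lst_add {X Y : Ω → ℝ} (hX : Measurable X) (hY : Measurable Y) (h : IndepFun X Y μ) (z : ℂ) :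
    lst μ (fun ω => X ω + Y ω) z = lst μ X z * lst μ Y z := by
  unfold lst
  rw [← h.integral_fun_comp_mul_comp (f := fun x : ℝ => exp (-z * x))
    (g := fun x : ℝ => exp (-z * x)) hX.aemeasurable hY.aemeasurable (by fun_prop) (by fun_prop)]
  congr 1
  ext ω
  rw [← exp_add]; push_cast; ring_nf

/-- On the imaginary axis the transforms of the positive and the negative part add up. -/
theorem lst_max_zero [IsProbabilityMeasure μ] {X : Ω → ℝ} (hX : Measurable X) {z : ℂ}
    (hz : z.re = 0) :
    lst μ (fun ω => max (X ω) 0) z = lst μ X z + 1 - lst μ (fun ω => min (X ω) 0) z := by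
  have hi : ∀ {Z : Ω → ℝ}, Measurable Z → Integrable (fun ω => exp (-z * Z ω)) μ := fun hZ =>
    integrable_exp_neg_mul hZ (ae_of_all _ fun ω => by rw [hz, zero_mul])
  have h1 : lst μ (fun ω => max (X ω) 0) z + lst μ (fun ω => min (X ω) 0) z = lst μ X z + 1 := by
    unfold lst
    rw [← integral_add (hi (hX.max measurable_const)) (hi (hX.min measurable_const))]
    have : (1 : ℂ) = ∫ _, 1 ∂μ := by simp
    rw [this, ← integral_add (hi hX) (integrable_const _)]
    congr 1
    ext ω
    rcases le_total (X ω) 0 with h | h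
    · simp [h, add_comm]
    · simp [h]
  linear_combination h1

end Transform

/-! ### Generating functions dominated by a geometric series -/

section GeometricSeries

variable {r : ℝ} {f : ℕ → ℂ → ℂ} {S : Set ℂ}

theorem norm_pow_mul_le (hr : 0 ≤ r) {x : ℂ} (hx : ‖x‖ ≤ 1) (i : ℕ) :
    ‖(r : ℂ) ^ i * x‖ ≤ r ^ i := by
  rw [norm_mul, norm_pow, norm_real, Real.norm_of_nonneg hr]
  exact mul_le_of_le_one_right (by positivity) hx

theorem summable_pow_mul (hr0 : 0 ≤ r) (hr1 : r < 1) {x : ℕ → ℂ} (hx : ∀ i, ‖x i‖ ≤ 1) :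
    Summable fun i => (r : ℂ) ^ i * x i :=
  (summable_geometric_of_lt_one hr0 hr1).of_norm_bounded fun i => norm_pow_mul_le hr0 (hx i) i

theorem norm_tsum_pow_mul_le (hr0 : 0 ≤ r) (hr1 : r < 1) {x : ℕ → ℂ} (hx : ∀ i, ‖x i‖ ≤ 1) :
    ‖∑' i, (r : ℂ) ^ i * x i‖ ≤ (1 - r)⁻¹ :=
  tsum_of_norm_bounded (hasSum_geometric_of_lt_one hr0 hr1) fun i => norm_pow_mul_le hr0 (hx i) i

theorem continuousOn_tsum_pow_mul (hr0 : 0 ≤ r) (hr1 : r < 1) (hc : ∀ i, ContinuousOn (f i) S)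
    (hf : ∀ i, ∀ z ∈ S, ‖f i z‖ ≤ 1) : ContinuousOn (fun z => ∑' i, (r : ℂ) ^ i * f i z) S :=
  continuousOn_tsum (fun i => continuousOn_const.mul (hc i))
    (summable_geometric_of_lt_one hr0 hr1) fun i z hz => norm_pow_mul_le hr0 (hf i z hz) i

theorem differentiableOn_tsum_pow_mul (hr0 : 0 ≤ r) (hr1 : r < 1) (hS : IsOpen S)
    (hd : ∀ i, DifferentiableOn ℂ (f i) S) (hf : ∀ i, ∀ z ∈ S, ‖f i z‖ ≤ 1) :
    DifferentiableOn ℂ (fun z => ∑' i, (r : ℂ) ^ i * f i z) S :=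
  differentiableOn_tsum_of_summable_norm (summable_geometric_of_lt_one hr0 hr1)
    (fun i => (hd i).const_mul _) hS fun i z hz => norm_pow_mul_le hr0 (hf i z hz) i

end GeometricSeries

end IndependenceAndTransforms

/-! ### Splitting off the atom of V and averaging over its negative values -/

section AtomSplitting

open Complex Set Filter Topology

section Split

variable {Ω : Type*} [MeasurableSpace Ω] {μ : Measure Ω}

theorem measurable_lst [IsFiniteMeasure μ] {X : Ω → ℝ} (hX : Measurable X) :
    Measurable (lst μ X) := by
  have h : StronglyMeasurable (Function.uncurry fun (z : ℂ) (ω : Ω) => exp (-z * X ω)) := by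
    apply Measurable.stronglyMeasurable
    simp only [Function.uncurry_def]
    fun_prop
  exact h.integral_prod_right.measurable

theorem continuousOn_lst_of_nonpos [IsFiniteMeasure μ] {X : Ω → ℝ} (hX : Measurable X)
    (h : ∀ᵐ ω ∂μ, X ω ≤ 0) : ContinuousOn (lst μ X) {z | z.re ≤ 0} := by
  have h1 := continuousOn_lst (μ := μ) hX.neg (by filter_upwards [h] with ω hω using by simpa using hω)
  refine (h1.comp continuousOn_id.neg fun z hz => by simpa using hz).congr fun z _ => ?_
  exact (congrArg (lst μ X) (neg_neg z).symm).trans (lst_neg X (-z)).symm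

theorem differentiableOn_lst_of_nonpos [IsFiniteMeasure μ] {X : Ω → ℝ} (hX : Measurable X)
    (h : ∀ᵐ ω ∂μ, X ω ≤ 0) : DifferentiableOn ℂ (lst μ X) {z | z.re < 0} := by
  have h1 := differentiableOn_lst (μ := μ) hX.neg
    (by filter_upwards [h] with ω hω using by simpa using hω)
  refine (h1.comp differentiableOn_id.neg fun z hz => by simpa using hz).congr fun z _ => ?_
  exact (congrArg (lst μ X) (neg_neg z).symm).trans (lst_neg X (-z)).symm

/-- The right side depends on V only through its law, so all V_i share one conditional law. -/
theorem negLaw_eq {V : Ω → ℝ} (hV : Measurable V) :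
    negLaw μ V = (μ.map V (Iio 0))⁻¹ • (μ.map V).restrict (Iio 0) := by
  rw [negLaw, ProbabilityTheory.cond, Measure.map_smul, Measure.restrict_map hV measurableSet_Iio,
    Measure.map_apply hV measurableSet_Iio]
  rfl

theorem negLaw_congr {V V' : Ω → ℝ} (hV : Measurable V) (hV' : Measurable V')
    (h : IdentDistrib V V' μ μ) : negLaw μ V = negLaw μ V' := by
  rw [negLaw_eq hV, negLaw_eq hV', h.map_eq]

theorem ae_negLaw_neg {V : Ω → ℝ} (hV : Measurable V) : ∀ᵐ y ∂negLaw μ V, y < 0 := by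
  rw [negLaw_eq hV]
  exact Measure.ae_smul_measure (ae_restrict_mem measurableSet_Iio) _

theorem measureReal_smul_negLaw [IsFiniteMeasure μ] {V : Ω → ℝ} (hV : Measurable V)
    (h0 : μ.real {ω | V ω < 0} ≠ 0) (f : ℝ → ℂ) :
    ∫ y in Iio 0, f y ∂(μ.map V) = μ.real {ω | V ω < 0} * ∫ y, f y ∂(negLaw μ V) := by
  rw [negLaw_eq hV, integral_smul_measure, Measure.map_apply hV measurableSet_Iio]
  have e : V ⁻¹' Iio 0 = {ω | V ω < 0} := rfl
  rw [e, ENNReal.toReal_inv, ← Measure.real, real_smul, ← mul_assoc, ofReal_inv, mul_inv_cancel₀,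
    one_mul]
  exact_mod_cast h0

theorem isProbabilityMeasure_negLaw [IsFiniteMeasure μ] {V : Ω → ℝ} (hV : Measurable V)
    (h0 : μ.real {ω | V ω < 0} ≠ 0) : IsProbabilityMeasure (negLaw μ V) := by
  have : IsProbabilityMeasure (μ[|{ω | V ω < 0}]) := by
    apply cond_isProbabilityMeasure
    intro h
    exact h0 (by simp [Measure.real, h])
  exact Measure.isProbabilityMeasure_map hV.aemeasurable

/-- Splitting off the atom of `V` in the transform of `V * W`. -/
theorem lst_mul_eq_add [IsProbabilityMeasure μ] {V W : Ω → ℝ} (hV : Measurable V)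
    (hW : Measurable W) (hVW : IndepFun W V μ) {a p : ℝ} (ha : 0 < a)
    (hVa : μ.real {ω | V ω = a} = p) (hVneg : μ.real {ω | V ω < 0} = 1 - p) {z : ℂ}
    (hz : z.re = 0) :
    lst μ (fun ω => V ω * W ω) z =
      p * lst μ W (a * z) + lst (μ.restrict {ω | V ω < 0}) (fun ω => V ω * W ω) z := by
  have hsa : MeasurableSet {ω | V ω = a} := hV (measurableSet_singleton a)
  have hsn : MeasurableSet {ω | V ω < 0} := hV measurableSet_Iio
  have hsub : {ω | V ω < 0} ⊆ {ω | V ω = a}ᶜ := by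
    intro ω hω h
    simp only [mem_ofPred_eq] at hω h
    linarith
  -- The inclusion uses a > 0; the masses p and 1 - p add up to one, so the difference is null.
  have hae : ({ω | V ω < 0} : Set Ω) =ᵐ[μ] ({ω | V ω = a}ᶜ : Set Ω) := by
    refine ae_eq_of_subset_of_measure_ge hsub ?_ hsn.nullMeasurableSet (measure_ne_top _ _)
    have h1 : μ.real {ω | V ω = a}ᶜ = μ.real {ω | V ω < 0} := by
      rw [probReal_compl_eq_one_sub hsa, hVa, hVneg]
    exact ((measureReal_eq_measureReal_iff (measure_ne_top _ _) (measure_ne_top _ _)).mp h1).le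
  have hint : Integrable (fun ω => exp (-z * (V ω * W ω : ℝ))) μ :=
    integrable_exp_neg_mul (hV.mul hW) (ae_of_all _ fun ω => by rw [hz, zero_mul])
  have h1 := integral_add_compl hsa hint
  have h2 : ∫ ω in {ω | V ω = a}, exp (-z * (V ω * W ω : ℝ)) ∂μ = p * lst μ W (a * z) := by
    have h3 := hVW.symm.integral_fun_comp_mul_comp (f := indicator {a} fun _ : ℝ => (1 : ℂ))
      (g := fun x : ℝ => exp (-(a * z) * x)) hV.aemeasurable hW.aemeasurable
      ((measurable_const.indicator (measurableSet_singleton a)).aestronglyMeasurable) (by fun_prop)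
    have h4 : ∫ ω, indicator {a} (fun _ : ℝ => (1 : ℂ)) (V ω) ∂μ = p := by
      have e : (fun ω => indicator {a} (fun _ : ℝ => (1 : ℂ)) (V ω)) =
          indicator {ω | V ω = a} fun _ => 1 := by
        ext ω; simp [indicator]
      rw [e, integral_indicator hsa]
      simp [hVa]
    rw [h4] at h3
    rw [lst, ← h3, ← integral_indicator hsa]
    congr 1
    ext ω
    by_cases h : V ω = a
    · simp only [indicator, mem_ofPred_eq, h, if_true, mem_singleton_iff, one_mul]
      congr 1; push_cast; ring
    · simp [indicator, h]
  rw [lst, ← h1, h2, ← setIntegral_congr_set hae]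
  rfl

/-- Fubini for the product of the laws of V and W. With Re z ≤ 0, V < 0 and W ≥ 0 the integrand is
bounded by 1; the indicator in `F` discards all other values of V. -/
theorem lst_mul_restrict_eq_integral [IsProbabilityMeasure μ] {V W : Ω → ℝ} (hV : Measurable V)
    (hW : Measurable W) (hW0 : ∀ ω, 0 ≤ W ω) (hVW : IndepFun W V μ)
    (h0 : μ.real {ω | V ω < 0} ≠ 0) {z : ℂ} (hz : z.re ≤ 0) :
    lst (μ.restrict {ω | V ω < 0}) (fun ω => V ω * W ω) z =
      μ.real {ω | V ω < 0} * ∫ y, lst μ W (z * (y : ℂ)) ∂(negLaw μ V) := by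
  have hsn : MeasurableSet {ω | V ω < 0} := hV measurableSet_Iio
  rw [← measureReal_smul_negLaw hV h0]
  let F : ℝ × ℝ → ℂ := indicator (Iio 0 ×ˢ univ) fun x => exp (-z * (x.1 * x.2 : ℝ))
  have hF : Measurable F := Measurable.indicator (by fun_prop) (measurableSet_Iio.prod .univ)
  have hmap := (indepFun_iff_map_prod_eq_prod_map_map hV.aemeasurable hW.aemeasurable).mp hVW.symm
  have : IsProbabilityMeasure (μ.map V) := Measure.isProbabilityMeasure_map hV.aemeasurable
  have : IsProbabilityMeasure (μ.map W) := Measure.isProbabilityMeasure_map hW.aemeasurable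
  have hFi : Integrable F ((μ.map V).prod (μ.map W)) := by
    rw [← hmap, integrable_map_measure hF.aestronglyMeasurable (hV.prodMk hW).aemeasurable]
    refine Integrable.of_bound (hF.comp (hV.prodMk hW)).aestronglyMeasurable 1
      (ae_of_all _ fun ω => ?_)
    by_cases h : V ω < 0
    · simp only [Function.comp, F, indicator, mem_prod, mem_Iio, h, mem_univ, and_true, if_true]
      exact norm_exp_neg_mul_ofReal_le_one
        (mul_nonneg_of_nonpos_of_nonpos hz (mul_nonpos_of_nonpos_of_nonneg h.le (hW0 ω)))
    · simp [F, h]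
  have e1 : lst (μ.restrict {ω | V ω < 0}) (fun ω => V ω * W ω) z = ∫ ω, F (V ω, W ω) ∂μ := by
    rw [lst, ← integral_indicator hsn]
    congr 1
    ext ω
    by_cases h : V ω < 0 <;> simp [F, h]
  rw [e1, ← integral_map (hV.prodMk hW).aemeasurable hF.aestronglyMeasurable, hmap,
    integral_prod _ hFi, ← integral_indicator measurableSet_Iio]
  congr 1
  ext y
  by_cases h : y < 0
  · simp only [F, indicator, mem_prod, mem_Iio, h, mem_univ, and_true, if_true]
    rw [lst, integral_map hW.aemeasurable (by fun_prop)]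
    congr 1
    ext ω
    congr 1; push_cast; ring
  · simp [F, indicator, h]

end Split

theorem exists_norm_eval_le {P : Polynomial ℂ} {n : ℕ} (h : P.natDegree ≤ n) :
    ∃ C : ℝ, 0 ≤ C ∧ ∀ z, ‖P.eval z‖ ≤ C * (1 + ‖z‖) ^ n := by
  refine ⟨∑ k ∈ Finset.range (n + 1), ‖P.coeff k‖, by positivity, fun z => ?_⟩
  rw [P.eval_eq_sum_range' (Nat.lt_succ_of_le h), Finset.sum_mul]
  refine (norm_sum_le _ _).trans (Finset.sum_le_sum fun k hk => ?_)
  rw [norm_mul, norm_pow]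
  gcongr
  calc ‖z‖ ^ k ≤ (1 + ‖z‖) ^ k := by gcongr; linarith
    _ ≤ (1 + ‖z‖) ^ n := pow_le_pow_right₀ (by linarith [norm_nonneg z])
        (Nat.lt_succ_iff.mp (Finset.mem_range.mp hk))

theorem coefSum_zero {n : ℕ} (c : Fin (n + 1) → ℂ) : coefSum c 0 = c 0 := by
  rw [coefSum, Finset.sum_eq_single 0] <;> simp +contextual

end AtomSplitting

/-! ### The functional equation and its polynomial -/

section FunctionalEquation

open Complex Set Filter Topology

variable {Ω : Type*} [MeasurableSpace Ω] {μ : Measure Ω}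

/-- The transform of the next state, multiplied by the denominator, on the imaginary axis. -/
theorem eval_mul_lst_process_succ [IsProbabilityMeasure μ] {V Y : ℕ → Ω → ℝ}
    (hV : ∀ i, Measurable (V i)) (hY : ∀ i, Measurable (Y i)) (hVi : iIndepFun V μ)
    (hYi : iIndepFun Y μ) (hVY : IndepFun (fun ω i => V i ω) (fun ω i => Y i ω) μ) {a p : ℝ}
    (ha : 0 < a) (i : ℕ) (hVa : μ.real {ω | V i ω = a} = p)
    (hVneg : μ.real {ω | V i ω < 0} = 1 - p) (w : ℝ) {D N : Polynomial ℂ} {z : ℂ} (hz : z.re = 0)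
    (hΦ : D.eval z * lst μ (Y i) z = N.eval z) :
    D.eval z * lst μ (process V Y w (i + 1)) z =
      p * N.eval z * lst μ (process V Y w i) (a * z) +
      N.eval z * lst (μ.restrict {ω | V i ω < 0}) (fun ω => V i ω * process V Y w i ω) z +
      D.eval z * (1 - lst μ (fun ω => min (V i ω * process V Y w i ω + Y i ω) 0) z) := by
  have hW := measurable_process hV hY w i
  have h1 := lst_max_zero (μ := μ) (((hV i).mul hW).add (hY i)) hz
  have h2 := lst_add ((hV i).mul hW) (hY i) (indepFun_mul_process hV hY hVi hYi hVY w i) z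
  have h3 := lst_mul_eq_add (hV i) hW
    ((indepFun_process hV hY hVi hYi hVY w i).comp measurable_id measurable_fst) ha hVa hVneg hz
  have h4 : lst μ (process V Y w (i + 1)) z =
      lst μ (fun ω => max (V i ω * process V Y w i ω + Y i ω) 0) z := rfl
  simp only [Pi.mul_apply, Pi.add_apply] at h1 h2 h3
  rw [h4]
  simp only [Pi.mul_def] at h1 h2
  linear_combination D.eval z * h1 + D.eval z * h2 + D.eval z * lst μ (Y i) z * h3 +
    (p * lst μ (process V Y w i) (a * z) +
      lst (μ.restrict {ω | V i ω < 0}) (fun ω => V i ω * process V Y w i ω) z) * hΦ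

theorem norm_genLST_le [IsProbabilityMeasure μ] {W : ℕ → Ω → ℝ} (hW : ∀ i ω, 0 ≤ W i ω) {r : ℝ}
    (hr0 : 0 ≤ r) (hr1 : r < 1) {z : ℂ} (hz : 0 ≤ z.re) : ‖genLST μ W r z‖ ≤ (1 - r)⁻¹ :=
  norm_tsum_pow_mul_le hr0 hr1 fun i =>
    norm_lst_le (by simp) (ae_of_all _ fun ω => mul_nonneg hz (hW i ω))

theorem genLST_zero [IsProbabilityMeasure μ] (W : ℕ → Ω → ℝ) {r : ℝ} (hr0 : 0 ≤ r) (hr1 : r < 1) :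
    genLST μ W r 0 = (1 - r : ℂ)⁻¹ := by
  simp only [genLST, lst_zero, mul_one]
  exact tsum_geometric_of_norm_lt_one (by rwa [norm_real, Real.norm_of_nonneg hr0])

/-- Both sides of the functional equation for the generating function extend to one polynomial. -/
theorem exists_coefSum_genLST [IsProbabilityMeasure μ] {V Y : ℕ → Ω → ℝ}
    (hV : ∀ i, Measurable (V i)) (hY : ∀ i, Measurable (Y i)) (hVi : iIndepFun V μ)
    (hYi : iIndepFun Y μ) (hVY : IndepFun (fun ω i => V i ω) (fun ω i => Y i ω) μ)
    (hVid : ∀ i, IdentDistrib (V i) (V 0) μ μ) {a p w : ℝ} (ha : 0 < a) (hp1 : p < 1)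
    (hw : 0 ≤ w) (hVa : μ.real {ω | V 0 ω = a} = p) (hVneg : μ.real {ω | V 0 ω < 0} = 1 - p)
    {D N : Polynomial ℂ} {n : ℕ} (hD : D.natDegree ≤ n) (hN : N.natDegree ≤ n)
    (hΦ : ∀ i (z : ℂ), z.re = 0 → D.eval z * lst μ (Y i) z = N.eval z)
    {r : ℝ} (hr0 : 0 < r) (hr1 : r < 1) :
    ∃ c : Fin (n + 1) → ℂ, c 0 = r / (1 - r) * (1 - p) * D.eval 0 ∧
      (∀ z : ℂ, 0 ≤ z.re → D.eval z * (genLST μ (process V Y w) r z - exp (-z * w)) -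
        (r * p : ℝ) * N.eval z * genLST μ (process V Y w) r (a * z) = coefSum c z) ∧
      ∀ z : ℂ, z.re ≤ 0 → D.eval z = 0 →
        r * (1 - p) * N.eval z *
          ∫ y, genLST μ (process V Y w) r (z * (y : ℂ)) ∂(negLaw μ (V 0)) = coefSum c z := by
  have hVa' : ∀ i, μ.real {ω | V i ω = a} = p := fun i => by
    rw [← hVa]
    exact congrArg ENNReal.toReal ((hVid i).measure_mem_eq (measurableSet_singleton a))
  have hVneg' : ∀ i, μ.real {ω | V i ω < 0} = 1 - p := fun i => by
    rw [← hVneg]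
    exact congrArg ENNReal.toReal ((hVid i).measure_mem_eq measurableSet_Iio)
  have hneg0 : ∀ i, μ.real {ω | V i ω < 0} ≠ 0 := fun i => by rw [hVneg']; linarith
  have hWm := measurable_process hV hY w
  have hW0 := process_nonneg (V := V) (Y := Y) hw
  set W := process V Y w with hWdef
  have hmr : ∀ i, (μ.restrict {ω | V i ω < 0}).real univ ≤ 1 := fun i => by
    rw [measureReal_restrict_apply MeasurableSet.univ]
    exact measureReal_le_one
  have hVW0 : ∀ i, ∀ᵐ ω ∂μ.restrict {ω | V i ω < 0}, V i ω * W i ω ≤ 0 := fun i => by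
    filter_upwards [ae_restrict_mem (s := {ω | V i ω < 0}) ((hV i) measurableSet_Iio)] with ω hω
    exact mul_nonpos_of_nonpos_of_nonneg (le_of_lt hω) (hW0 i ω)
  -- `G i` and `M i` are transforms of nonpositive variables and live on Re z ≤ 0; the transforms of
  -- `W i` live on Re z ≥ 0.
  let G : ℕ → ℂ → ℂ := fun i z => lst (μ.restrict {ω | V i ω < 0}) (fun ω => V i ω * W i ω) z
  let M : ℕ → ℂ → ℂ := fun i z => lst μ (fun ω => min (V i ω * W i ω + Y i ω) 0) z
  have hMm : ∀ i, Measurable fun ω => min (V i ω * W i ω + Y i ω) 0 := fun i =>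
    (((hV i).mul (hWm i)).add (hY i)).min measurable_const
  have hM0 : ∀ i, ∀ᵐ ω ∂μ, min (V i ω * W i ω + Y i ω) 0 ≤ 0 := fun i =>
    ae_of_all _ fun ω => min_le_right _ _
  have hφ1 : ∀ i (z : ℂ), 0 ≤ z.re → ‖lst μ (W i) z‖ ≤ 1 := fun i z hz =>
    norm_lst_le (by simp) (ae_of_all _ fun ω => mul_nonneg hz (hW0 i ω))
  have hG1 : ∀ i (z : ℂ), z.re ≤ 0 → ‖G i z‖ ≤ 1 := fun i z hz =>
    norm_lst_le (hmr i)
      (by filter_upwards [hVW0 i] with ω hω using mul_nonneg_of_nonpos_of_nonpos hz hω)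
  have hM1 : ∀ i (z : ℂ), z.re ≤ 0 → ‖M i z‖ ≤ 1 := fun i z hz =>
    norm_lst_le (by simp)
      (by filter_upwards [hM0 i] with ω hω using mul_nonneg_of_nonpos_of_nonpos hz hω)
  let U : ℂ → ℂ := genLST μ W r
  have hUb : ∀ z : ℂ, 0 ≤ z.re → ‖U z‖ ≤ (1 - r)⁻¹ := fun z hz => norm_genLST_le hW0 hr0.le hr1 hz
  have hUc : ContinuousOn U {z | 0 ≤ z.re} := continuousOn_tsum_pow_mul hr0.le hr1
    (fun i => continuousOn_lst (hWm i) (ae_of_all _ (hW0 i))) hφ1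
  have hUd : DifferentiableOn ℂ U {z | 0 < z.re} := differentiableOn_tsum_pow_mul hr0.le hr1
    (isOpen_lt continuous_const continuous_re)
    (fun i => differentiableOn_lst (hWm i) (ae_of_all _ (hW0 i))) fun i z hz => hφ1 i z (le_of_lt hz)
  let SG : ℂ → ℂ := fun z => ∑' i, (r : ℂ) ^ i * G i z
  let SM : ℂ → ℂ := fun z => ∑' i, (r : ℂ) ^ i * M i z
  have hSGc : ContinuousOn SG {z | z.re ≤ 0} := continuousOn_tsum_pow_mul hr0.le hr1
    (fun i => continuousOn_lst_of_nonpos ((hV i).mul (hWm i)) (hVW0 i)) hG1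
  have hSMc : ContinuousOn SM {z | z.re ≤ 0} := continuousOn_tsum_pow_mul hr0.le hr1
    (fun i => continuousOn_lst_of_nonpos (hMm i) (hM0 i)) hM1
  have hSGd : DifferentiableOn ℂ SG {z | z.re < 0} := differentiableOn_tsum_pow_mul hr0.le hr1
    (isOpen_lt continuous_re continuous_const)
    (fun i => differentiableOn_lst_of_nonpos ((hV i).mul (hWm i)) (hVW0 i))
    fun i z hz => hG1 i z (le_of_lt hz)
  have hSMd : DifferentiableOn ℂ SM {z | z.re < 0} := differentiableOn_tsum_pow_mul hr0.le hr1
    (isOpen_lt continuous_re continuous_const)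
    (fun i => differentiableOn_lst_of_nonpos (hMm i) (hM0 i)) fun i z hz => hM1 i z (le_of_lt hz)
  have hare : ∀ z : ℂ, (a * z : ℂ).re = a * z.re := fun z => by simp
  let L : ℂ → ℂ := fun z =>
    D.eval z * (U z - exp (-z * w)) - (r * p : ℝ) * N.eval z * U (a * z)
  let R : ℂ → ℂ := fun z => r * N.eval z * SG z + D.eval z * (r / (1 - r) - r * SM z)
  obtain ⟨CD, hCD0, hCD⟩ := exists_norm_eval_le hD
  obtain ⟨CN, hCN0, hCN⟩ := exists_norm_eval_le hN
  have hrinv : (0 : ℝ) < (1 - r)⁻¹ := inv_pos.mpr (by linarith)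
  have hgeom : HasSum (fun i : ℕ => (r : ℂ) ^ i) (1 - r : ℂ)⁻¹ :=
    hasSum_geometric_of_norm_lt_one (by rwa [norm_real, Real.norm_of_nonneg hr0.le])
  have hr1c : (1 - r : ℂ) ≠ 0 := by
    rw [sub_ne_zero]; exact_mod_cast hr1.ne'
  have hLR : ∀ z : ℂ, z.re = 0 → L z = R z := by
    intro z hz
    have hU : U z = exp (-z * w) + r * ∑' i, (r : ℂ) ^ i * lst μ (W (i + 1)) z := by
      have h1 := (summable_pow_mul hr0.le hr1 fun i => hφ1 i z hz.ge).tsum_eq_zero_add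
      have h2 : lst μ (W 0) z = exp (-z * w) := by
        simp [lst, hWdef, process]
      rw [pow_zero, one_mul, h2] at h1
      rw [← tsum_mul_left]
      refine h1.trans ?_
      congr 2
      ext i; ring
    have hs1 := (summable_pow_mul hr0.le hr1 fun i => hφ1 (i + 1) z hz.ge).hasSum.mul_left (D.eval z)
    have hs2 := (summable_pow_mul hr0.le hr1 fun i =>
      hφ1 i (a * z) (by rw [hare, hz, mul_zero])).hasSum.mul_left (p * N.eval z)
    have hs3 := (summable_pow_mul hr0.le hr1 fun i => hG1 i z hz.le).hasSum.mul_left (N.eval z)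
    have hs4 := (hgeom.sub (summable_pow_mul hr0.le hr1 fun i =>
      hM1 i z hz.le).hasSum).mul_left (D.eval z)
    have hs := hs1.unique (((hs2.add hs3).add hs4).congr_fun fun i => by
      have := eval_mul_lst_process_succ hV hY hVi hYi hVY ha i (hVa' i) (hVneg' i) w (D := D)
        (N := N) hz (hΦ i z hz)
      simp only [G, M]
      linear_combination (r : ℂ) ^ i * this)
    simp only [L, R]
    rw [hU]
    push_cast
    have e : U (a * z) = ∑' i, (r : ℂ) ^ i * lst μ (W i) (a * z) := rfl
    rw [e, div_eq_mul_inv]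
    linear_combination (r : ℂ) * hs
  have hLc : ContinuousOn L {z | 0 ≤ z.re} := by
    have h1 : ContinuousOn (fun z : ℂ => U (a * z)) {z | 0 ≤ z.re} :=
      hUc.comp (by fun_prop) fun z hz => by
        change 0 ≤ (a * z : ℂ).re
        rw [hare]; exact mul_nonneg ha.le hz
    exact (D.continuous.continuousOn.mul (hUc.sub (by fun_prop))).sub
      ((continuousOn_const.mul N.continuous.continuousOn).mul h1)
  have hLd : DifferentiableOn ℂ L {z | 0 < z.re} := by
    have h1 : DifferentiableOn ℂ (fun z : ℂ => U (a * z)) {z | 0 < z.re} :=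
      hUd.comp (by fun_prop) fun z hz => by
        change 0 < (a * z : ℂ).re
        rw [hare]; exact mul_pos ha hz
    exact (D.differentiable.differentiableOn.mul (hUd.sub (by fun_prop))).sub
      ((N.differentiable.differentiableOn.const_mul _).mul h1)
  have hRc : ContinuousOn R {z | z.re ≤ 0} :=
    ((continuousOn_const.mul N.continuous.continuousOn).mul hSGc).add
      (D.continuous.continuousOn.mul (continuousOn_const.sub (continuousOn_const.mul hSMc)))
  have hRd : DifferentiableOn ℂ R {z | z.re < 0} :=
    ((N.differentiable.differentiableOn.const_mul _).mul hSGd).add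
      (D.differentiable.differentiableOn.mul ((hSMd.const_mul _).const_sub _))
  have hLb : ∀ z : ℂ, 0 ≤ z.re → ‖L z‖ ≤
      (CD * ((1 - r)⁻¹ + 1) + ‖((r * p : ℝ) : ℂ)‖ * CN * (1 - r)⁻¹) * (1 + ‖z‖) ^ n := by
    intro z hz
    have h1 := hUb z hz
    have h2 := hUb (a * z) (by rw [hare]; exact mul_nonneg ha.le hz)
    have h3 : ‖exp (-z * w)‖ ≤ 1 := norm_exp_neg_mul_ofReal_le_one (mul_nonneg hz hw)
    calc ‖L z‖ ≤ ‖D.eval z‖ * (‖U z‖ + ‖exp (-z * w)‖) +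
          ‖((r * p : ℝ) : ℂ)‖ * ‖N.eval z‖ * ‖U (a * z)‖ := by
            refine (norm_sub_le _ _).trans ?_
            rw [norm_mul, norm_mul, norm_mul]
            gcongr
            exact norm_sub_le _ _
      _ ≤ CD * (1 + ‖z‖) ^ n * ((1 - r)⁻¹ + 1) +
          ‖((r * p : ℝ) : ℂ)‖ * (CN * (1 + ‖z‖) ^ n) * (1 - r)⁻¹ := by
            gcongr
            · exact hCD z
            · exact hCN z
      _ = _ := by ring
  have hRb : ∀ z : ℂ, z.re ≤ 0 → ‖R z‖ ≤
      (r * CN * (1 - r)⁻¹ + CD * (‖(r / (1 - r) : ℂ)‖ + r * (1 - r)⁻¹)) * (1 + ‖z‖) ^ n := by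
    intro z hz
    have h1 : ‖SG z‖ ≤ (1 - r)⁻¹ := norm_tsum_pow_mul_le hr0.le hr1 fun i => hG1 i z hz
    have h2 : ‖SM z‖ ≤ (1 - r)⁻¹ := norm_tsum_pow_mul_le hr0.le hr1 fun i => hM1 i z hz
    have hrn : ‖(r : ℂ)‖ = r := by rw [norm_real, Real.norm_of_nonneg hr0.le]
    calc ‖R z‖ ≤ ‖(r : ℂ)‖ * ‖N.eval z‖ * ‖SG z‖ +
          ‖D.eval z‖ * (‖(r / (1 - r) : ℂ)‖ + ‖(r : ℂ)‖ * ‖SM z‖) := by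
            refine (norm_add_le _ _).trans ?_
            rw [norm_mul, norm_mul, norm_mul, ← norm_mul (r : ℂ) (SM z)]
            gcongr
            exact norm_sub_le _ _
      _ ≤ r * (CN * (1 + ‖z‖) ^ n) * (1 - r)⁻¹ +
          CD * (1 + ‖z‖) ^ n * (‖(r / (1 - r) : ℂ)‖ + r * (1 - r)⁻¹) := by
            rw [hrn]
            gcongr
            · exact hCN z
            · exact hCD z
      _ = _ := by ring
  obtain ⟨c, hcL, hcR⟩ := exists_coefSum_of_halfPlanes hLc hLd hRc hRd hLR
    (C := max (CD * ((1 - r)⁻¹ + 1) + ‖((r * p : ℝ) : ℂ)‖ * CN * (1 - r)⁻¹)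
      (r * CN * (1 - r)⁻¹ + CD * (‖(r / (1 - r) : ℂ)‖ + r * (1 - r)⁻¹))) (n := n)
    (fun z hz => (hLb z hz).trans (by gcongr; exact le_max_left _ _))
    (fun z hz => (hRb z hz).trans (by gcongr; exact le_max_right _ _))
  refine ⟨c, ?_, hcL, ?_⟩
  -- At 0 all transforms equal 1, so D(0) = N(0) and U(0) = 1/(1-r); this fixes the constant
  -- coefficient.
  · have h1 := hcL 0 (by simp)
    have h2 : U 0 = (1 - r : ℂ)⁻¹ := genLST_zero W hr0.le hr1
    have h3 : D.eval 0 = N.eval 0 := by simpa [lst_zero] using hΦ 0 0 (by simp)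
    rw [coefSum_zero] at h1
    rw [← h1]
    simp only [L, mul_zero, h2, neg_zero, zero_mul, exp_zero, ← h3]
    push_cast
    field_simp
    ring
  · intro z hz hDz
    rw [← hcR z hz]
    -- At a zero of D the unknown transforms of the negative part drop out, and only `SG` has to be
    -- identified.
    simp only [R, hDz, zero_mul, add_zero]
    have hprob := isProbabilityMeasure_negLaw (hV 0) (hneg0 0)
    have hmeas : ∀ i, Measurable fun y : ℝ => (r : ℂ) ^ i * lst μ (W i) (z * (y : ℂ)) := fun i =>
      ((measurable_lst (hWm i)).comp (by fun_prop : Measurable fun y : ℝ => z * (y : ℂ))).const_mul _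
    have hbound : ∀ i, ∀ᵐ (y : ℝ) ∂negLaw μ (V 0),
        ‖(r : ℂ) ^ i * lst μ (W i) (z * (y : ℂ))‖ ≤ r ^ i := fun i => by
      filter_upwards [ae_negLaw_neg (hV 0)] with y hy
      refine norm_pow_mul_le hr0.le (hφ1 i _ ?_) i
      simpa using mul_nonneg_of_nonpos_of_nonpos hz hy.le
    -- For y < 0 the point zy lies in Re ≥ 0, so the i-th term is at most r^i; this permits
    -- exchanging sum and integral.
    have hsum := hasSum_integral_of_summable_integral_norm (μ := negLaw μ (V 0))
      (F := fun i y => (r : ℂ) ^ i * lst μ (W i) (z * (y : ℂ)))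
      (fun i => Integrable.of_bound (hmeas i).aestronglyMeasurable (r ^ i) (hbound i))
      ((summable_geometric_of_lt_one hr0.le hr1).of_nonneg_of_le
        (fun i => integral_nonneg fun _ => norm_nonneg _) fun i => by
          have := integral_mono_ae (μ := negLaw μ (V 0))
            (Integrable.of_bound (hmeas i).aestronglyMeasurable (r ^ i) (hbound i)).norm
            (integrable_const (r ^ i)) (hbound i)
          simpa using this)
    have hG : ∀ i, G i z = (1 - p) * ∫ y, lst μ (W i) (z * (y : ℂ)) ∂negLaw μ (V 0) := fun i => by
      have := lst_mul_restrict_eq_integral (hV i) (hWm i) (hW0 i)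
        ((indepFun_process hV hY hVi hYi hVY w i).comp measurable_id measurable_fst) (hneg0 i) hz
      rw [hVneg' i, negLaw_congr (hV i) (hV 0) (hVid i)] at this
      push_cast at this
      exact this
    have hSG : SG z = (1 - p) * ∫ y, U (z * (y : ℂ)) ∂negLaw μ (V 0) := by
      have e : ∫ y, U (z * (y : ℂ)) ∂negLaw μ (V 0) =
        ∫ y : ℝ, ∑' i, (r : ℂ) ^ i * lst μ (W i) (z * (y : ℂ)) ∂negLaw μ (V 0) := rfl
      rw [e, ← (hsum.mul_left (1 - p : ℂ)).tsum_eq]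
      refine tsum_congr fun i => ?_
      rw [hG i, integral_const_mul]
      ring
    rw [hSG]
    simp only [U]
    ring

end FunctionalEquation

/-! ### Numerator and denominator of the transform of Y -/

section RationalTransforms

open Complex Set Filter Topology

section Denominator

open Polynomial

variable {l m : ℕ} (s : Fin l → ℂ) (t : Fin m → ℂ)

theorem eval_poleDen {n : ℕ} (s : Fin n → ℂ) (z : ℂ) : (poleDen s).eval z = ∏ i, (z - s i) := by
  simp [poleDen, eval_prod]

theorem poleDen_monic {n : ℕ} (s : Fin n → ℂ) : (poleDen s).Monic :=
  monic_prod_of_monic _ _ fun i _ => monic_X_sub_C (s i)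

theorem natDegree_poleDen {n : ℕ} (s : Fin n → ℂ) : (poleDen s).natDegree = n := by
  simp [poleDen, natDegree_prod_of_monic _ _ fun i _ => monic_X_sub_C (s i)]

theorem roots_poleDen {n : ℕ} (s : Fin n → ℂ) :
    (poleDen s).roots = (Finset.univ : Finset (Fin n)).val.map s := by
  have h : poleDen s = ((Finset.univ.val.map s).map fun x => X - C x).prod := by
    rw [Multiset.map_map]; rfl
  rw [h, roots_multiset_prod_X_sub_C]

theorem poleDen_comp_neg_X : (poleDen t).comp (-X) = C ((-1) ^ m) * poleDen fun i => -t i := by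
  have h : ∀ i, (-X - C (t i) : ℂ[X]) = C (-1) * (X - C (-t i)) := fun i => by
    simp only [C_neg, C_1]; ring
  simp only [poleDen, prod_comp, sub_comp, X_comp, C_comp, h, Finset.prod_mul_distrib,
    Finset.prod_const]
  simp

theorem denY_eq : denY s t = C ((-1) ^ m) * (poleDen s * poleDen fun i => -t i) := by
  rw [denY, poleDen_comp_neg_X]; ring

theorem eval_denY (z : ℂ) : (denY s t).eval z = (∏ j, (z - s j)) * ∏ i, (-z - t i) := by
  simp [denY, eval_poleDen, eval_comp]

theorem eval_denY_zero :
    (denY s t).eval 0 = (-1) ^ (l + m) * (∏ j, s j) * ∏ i, t i := by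
  simp [eval_denY, Finset.prod_neg, pow_add]; ring

theorem natDegree_denY : (denY s t).natDegree = m + l := by
  rw [denY_eq, natDegree_C_mul (by simp), (poleDen_monic s).natDegree_mul (poleDen_monic _),
    natDegree_poleDen, natDegree_poleDen, add_comm]

theorem denY_ne_zero : denY s t ≠ 0 := by
  rw [denY_eq]
  exact mul_ne_zero (by simp) ((poleDen_monic s).mul (poleDen_monic _)).ne_zero

theorem eval_denY_left (j : Fin l) : (denY s t).eval (s j) = 0 := by
  rw [eval_denY, Finset.prod_eq_zero (Finset.mem_univ j) (sub_self _), zero_mul]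

theorem eval_denY_right (i : Fin m) : (denY s t).eval (-t i) = 0 := by
  rw [eval_denY, Finset.prod_eq_zero (i := i) (Finset.mem_univ i) (by ring : - -t i - t i = 0),
    mul_zero]

variable {s t}

theorem eval_poleDen_ne_zero {n : ℕ} {s : Fin n → ℂ} (hs : ∀ j, (s j).re < 0) {z : ℂ}
    (hz : 0 ≤ z.re) : (poleDen s).eval z ≠ 0 := by
  rw [eval_poleDen]
  refine Finset.prod_ne_zero_iff.mpr fun j _ h => ?_
  rw [sub_eq_zero.mp h] at hz
  exact absurd (hs j) (not_lt.mpr hz)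

theorem card_filter_roots_denY (hs : ∀ j, (s j).re < 0) (ht : ∀ i, (t i).re < 0) :
    ((denY s t).roots.filter fun z => 0 < z.re).card = m := by
  rw [denY_eq, roots_C_mul _ (by simp),
    roots_mul (mul_ne_zero (poleDen_monic s).ne_zero (poleDen_monic _).ne_zero), roots_poleDen,
    roots_poleDen, Multiset.filter_add, Multiset.card_add]
  have h1 : ((Finset.univ : Finset (Fin l)).val.map s).filter (fun z => 0 < z.re) = 0 := by
    rw [Multiset.filter_eq_nil]
    intro z hz
    obtain ⟨j, _, rfl⟩ := Multiset.mem_map.mp hz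
    exact not_lt.mpr (hs j).le
  have h2 : ((Finset.univ : Finset (Fin m)).val.map fun i => -t i).filter (fun z => 0 < z.re) =
      (Finset.univ : Finset (Fin m)).val.map fun i => -t i := by
    rw [Multiset.filter_eq_self]
    intro z hz
    obtain ⟨i, _, rfl⟩ := Multiset.mem_map.mp hz
    simpa using ht i
  rw [h1, h2]
  simp

theorem natDegree_comp_neg_X_le (P : ℂ[X]) : (P.comp (-X)).natDegree ≤ P.natDegree := by
  refine natDegree_comp_le.trans ?_
  simp

/-- Strictness makes Φ_Y vanish at infinity, as needed both for counting zeros and for the ratio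
test along unbounded orbits. -/
theorem degree_numY_lt_degree_denY {NB NA : ℂ[X]} (hB : NB.degree < l) (hA : NA.degree < m)
    (hB0 : NB ≠ 0) (hA0 : NA ≠ 0) : (numY NB NA).degree < (denY s t).degree := by
  have h1 := (natDegree_lt_iff_degree_lt hB0).mpr hB
  have h2 := (natDegree_lt_iff_degree_lt hA0).mpr hA
  refine (degree_le_natDegree).trans_lt ?_
  rw [degree_eq_natDegree (denY_ne_zero s t), natDegree_denY]
  have h3 : (numY NB NA).natDegree ≤ NB.natDegree + NA.natDegree :=
    natDegree_mul_le.trans (by gcongr; exact natDegree_comp_neg_X_le NA)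
  exact_mod_cast (by omega : (numY NB NA).natDegree < m + l)

end Denominator

section RationalTransform

variable {Ω : Type*} [MeasurableSpace Ω] {μ : Measure Ω}

theorem HasRationalLST.num_ne_zero [IsProbabilityMeasure μ] {X : Ω → ℝ} {n : ℕ} {s : Fin n → ℂ}
    {N : Polynomial ℂ} (h : HasRationalLST μ X s N) : N ≠ 0 := by
  rintro rfl
  have := h.lst_eq 0 (by simp)
  simp [lst_zero] at this

/-- Only for Re z = 0 do both z and -z lie in the half-plane where the rational formulas are given.
-/
theorem eval_denY_mul_lst_sub {A B : Ω → ℝ} (hAm : Measurable A) (hBm : Measurable B)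
    (hAB : IndepFun A B μ) {l m : ℕ} {s : Fin l → ℂ} {t : Fin m → ℂ} {NB NA : Polynomial ℂ}
    (hs : ∀ j, (s j).re < 0) (ht : ∀ i, (t i).re < 0)
    (hB : ∀ z : ℂ, 0 ≤ z.re → lst μ B z = NB.eval z / (poleDen s).eval z)
    (hA : ∀ z : ℂ, 0 ≤ z.re → lst μ A z = NA.eval z / (poleDen t).eval z) {z : ℂ}
    (hz : z.re = 0) :
    (denY s t).eval z * lst μ (fun ω => B ω - A ω) z = (numY NB NA).eval z := by
  have hz' : (-z).re = 0 := by simp [hz]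
  have h1 := lst_add hBm hAm.neg (hAB.symm.comp measurable_id measurable_neg) z
  have h2 : lst μ (fun ω => B ω - A ω) z = lst μ B z * lst μ A (-z) := by
    simp only [sub_eq_add_neg]
    exact h1.trans (congrArg _ (lst_neg A z))
  have h3 := eval_poleDen_ne_zero hs hz.ge
  have h4 := eval_poleDen_ne_zero ht hz'.ge
  rw [h2, hB z hz.ge, hA (-z) hz'.ge]
  simp only [denY, numY, Polynomial.eval_mul, Polynomial.eval_comp, Polynomial.eval_neg,
    Polynomial.eval_X]
  field_simp

end RationalTransform

/-! ### Bounds for rational functions along curves and geometric orbits -/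

section Bounds

open Polynomial

/-- Near infinity P = O(E); on the remaining ball P is bounded, and the summand 1 takes care of the
zeros of E. -/
theorem exists_norm_eval_le_add {P E : ℂ[X]} (h : P.degree ≤ E.degree) :
    ∃ C : ℝ, 0 ≤ C ∧ ∀ z, ‖P.eval z‖ ≤ C * (1 + ‖E.eval z‖) := by
  obtain ⟨C₁, hC₁⟩ := (isBigO_cobounded_of_degree_le h).bound
  obtain ⟨R, -, hR⟩ := (Metric.hasBasis_cobounded_compl_closedBall (0 : ℂ)).eventually_iff.mp hC₁
  obtain ⟨C₂, hC₂⟩ := (isCompact_closedBall (0 : ℂ) R).exists_bound_of_continuousOn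
    P.continuous.continuousOn
  refine ⟨max (max C₁ C₂) 0, le_max_right _ _, fun z => ?_⟩
  have hm : max C₁ C₂ ≤ max (max C₁ C₂) 0 := le_max_left _ _
  have h1 := (le_max_left C₁ C₂).trans hm
  have h2 := (le_max_right C₁ C₂).trans hm
  have h0 : 0 ≤ max (max C₁ C₂) 0 := le_max_right _ _
  have hE := norm_nonneg (E.eval z)
  by_cases hz : z ∈ Metric.closedBall (0 : ℂ) R
  · have := hC₂ z hz
    nlinarith
  · have := hR hz
    nlinarith

/-- If `1 / E` is integrable along a curve, then so is `P / E` when `P` has at most the degree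
of `E`. -/
theorem integrable_eval_div_eval {α : Type*} [MeasurableSpace α] {ν : Measure α} [IsFiniteMeasure ν]
    {P E : ℂ[X]} (h : P.degree ≤ E.degree) {ζ : α → ℂ} (hζ : Measurable ζ)
    (hi : Integrable (fun y => 1 / E.eval (ζ y)) ν) :
    Integrable (fun y => P.eval (ζ y) / E.eval (ζ y)) ν := by
  obtain ⟨C, hC0, hC⟩ := exists_norm_eval_le_add h
  refine ((hi.norm.add (integrable_const 1)).const_mul C).mono' ?_ (ae_of_all _ fun y => ?_)
  · exact ((P.continuous.measurable.comp hζ).div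
      (E.continuous.measurable.comp hζ)).aestronglyMeasurable
  · simp only [Pi.add_apply, norm_div, norm_one]
    -- Division by zero gives 0, so the bound is trivial at zeros of E.
    by_cases h0 : E.eval (ζ y) = 0
    · simp [h0, hC0]
    · have h1 : 0 < ‖E.eval (ζ y)‖ := norm_pos_iff.mpr h0
      rw [div_le_iff₀ h1]
      have := hC (ζ y)
      have e : C * (1 / ‖E.eval (ζ y)‖ + 1) * ‖E.eval (ζ y)‖ = C * (1 + ‖E.eval (ζ y)‖) := by
        field_simp
      rwa [e]

theorem tendsto_pow_mul_or {a : ℝ} (ha0 : 0 < a) (ha1 : a ≠ 1) (z : ℂ) :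
    Tendsto (fun h : ℕ => (a : ℂ) ^ h * z) atTop (𝓝 0) ∨
      Tendsto (fun h : ℕ => (a : ℂ) ^ h * z) atTop (Bornology.cobounded ℂ) := by
  rcases lt_or_gt_of_ne ha1 with h | h
  · left
    have h1 : Tendsto (fun h : ℕ => (a : ℂ) ^ h) atTop (𝓝 0) :=
      tendsto_pow_atTop_nhds_zero_of_norm_lt_one (by rwa [norm_real, Real.norm_of_nonneg ha0.le])
    simpa using h1.mul_const z
  · by_cases hz : z = 0
    · left; simp [hz]
    · right
      rw [← tendsto_norm_atTop_iff_cobounded]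
      simp only [norm_mul, norm_pow, norm_real, Real.norm_of_nonneg ha0.le]
      exact (tendsto_pow_atTop_atTop_of_one_lt h).atTop_mul_const (norm_pos_iff.mpr hz)

variable {D N : ℂ[X]} {a q : ℝ}

/-- The orbit tends to 0, where the quotient is continuous, or to infinity, where the degrees bound
it; the finitely many other terms do not matter. -/
theorem exists_bound_eval_div_eval_pow (ha0 : 0 < a) (ha1 : a ≠ 1) (hD0 : D.eval 0 ≠ 0) {P : ℂ[X]}
    (hP : P.degree ≤ D.degree) (z : ℂ) :
    ∃ C : ℝ, ∀ h : ℕ, ‖P.eval ((a : ℂ) ^ h * z) / D.eval ((a : ℂ) ^ h * z)‖ ≤ C := by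
  have hb : (fun h : ℕ => P.eval ((a : ℂ) ^ h * z) / D.eval ((a : ℂ) ^ h * z)) =O[atTop]
      fun _ => (1 : ℝ) := by
    rcases tendsto_pow_mul_or ha0 ha1 z with h | h
    · exact (((P.continuous.tendsto 0).comp h).div ((D.continuous.tendsto 0).comp h)
        hD0).isBigO_one ℝ
    · have h1 := (isBigO_cobounded_of_degree_le hP).comp_tendsto h
      obtain ⟨C, hC0, hC⟩ := h1.exists_nonneg
      refine Asymptotics.IsBigO.of_bound C ?_
      filter_upwards [hC.bound] with k hk
      rw [norm_div, norm_one, mul_one]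
      exact div_le_of_le_mul₀ (norm_nonneg _) hC0 hk
  obtain ⟨C, hC⟩ := Asymptotics.isBigO_one_nat_atTop_iff.mp hb
  exact ⟨C, hC⟩

theorem prodPhi_succ (D N : ℂ[X]) (a : ℝ) (z : ℂ) (h : ℕ) : prodPhi D N a z (h + 1) =
    prodPhi D N a z h * (N.eval ((a : ℂ) ^ h * z) / D.eval ((a : ℂ) ^ h * z)) :=
  Finset.prod_range_succ _ _

/-- Ratio test: q|Φ(a^h z)| tends to q if the orbit tends to 0, because Φ(0) = 1, and to 0 if it
tends to infinity. -/
theorem summable_norm_pow_mul_prodPhi (ha0 : 0 < a) (ha1 : a ≠ 1) (hq0 : 0 ≤ q) (hq1 : q < 1)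
    (hD0 : D.eval 0 ≠ 0) (hDN : D.eval 0 = N.eval 0) (hdeg : N.degree < D.degree) (z : ℂ) :
    Summable fun h => ‖(q : ℂ) ^ h * prodPhi D N a z h‖ := by
  have hlim : ∃ L : ℝ, L < 1 ∧ Tendsto (fun h : ℕ =>
      q * ‖N.eval ((a : ℂ) ^ h * z) / D.eval ((a : ℂ) ^ h * z)‖) atTop (𝓝 L) := by
    rcases tendsto_pow_mul_or ha0 ha1 z with h | h
    · refine ⟨q, hq1, ?_⟩
      have h1 := (((N.continuous.tendsto 0).comp h).div ((D.continuous.tendsto 0).comp h)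
        hD0).norm.const_mul q
      rwa [← hDN, div_self hD0, norm_one, mul_one] at h1
    · refine ⟨0, zero_lt_one, ?_⟩
      have h1 := ((isLittleO_cobounded_of_degree_lt hdeg).tendsto_div_nhds_zero.comp
        h).norm.const_mul q
      rwa [norm_zero, mul_zero] at h1
  obtain ⟨L, hL, hlim⟩ := hlim
  obtain ⟨ρ, hLρ, hρ⟩ := exists_between hL
  refine summable_of_ratio_norm_eventually_le hρ ?_
  filter_upwards [hlim.eventually (gt_mem_nhds hLρ)] with h hh
  have e : (q : ℂ) ^ (h + 1) * prodPhi D N a z (h + 1) =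
      (q * (N.eval ((a : ℂ) ^ h * z) / D.eval ((a : ℂ) ^ h * z))) *
        ((q : ℂ) ^ h * prodPhi D N a z h) := by
    rw [prodPhi_succ, pow_succ]; ring
  rw [norm_norm, norm_norm, e, norm_mul, norm_mul (q : ℂ), norm_real, Real.norm_of_nonneg hq0]
  exact mul_le_mul_of_nonneg_right hh.le (norm_nonneg _)

end Bounds

end RationalTransforms

/-! ### Solving for U and extracting linear equations for the coefficients -/

section CoefficientEquations

open Complex Set Filter Topology Polynomial

section CoefPoly

/-- The polynomial with coefficients `c`. -/
noncomputable def coefPoly {n : ℕ} (c : Fin n → ℂ) : ℂ[X] := ∑ k, C (c k) * X ^ (k : ℕ)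

theorem eval_coefPoly {n : ℕ} (c : Fin n → ℂ) (z : ℂ) : (coefPoly c).eval z = coefSum c z := by
  simp [coefPoly, coefSum, eval_finsetSum]

theorem degree_coefPoly_le {n : ℕ} (c : Fin (n + 1) → ℂ) : (coefPoly c).degree ≤ n := by
  refine (degree_sum_le _ _).trans (Finset.sup_le fun k _ => ?_)
  refine (degree_C_mul_X_pow_le _ _).trans ?_
  exact_mod_cast Nat.lt_succ_iff.mp k.2

theorem eval_eq_sum_fin {P : ℂ[X]} {n : ℕ} (h : P.natDegree ≤ n) (z : ℂ) :
    P.eval z = ∑ k : Fin (n + 1), P.coeff k * z ^ (k : ℕ) := by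
  rw [P.eval_eq_sum_range' (Nat.lt_succ_of_le h), Finset.sum_range]

end CoefPoly

section AtomOne

variable {D N : ℂ[X]} {n : ℕ} {c : Fin (n + 1) → ℂ} {w : ℝ}

/-- The equation at a pole, split according to the coefficients, for an atom at `1`. -/
theorem sum_coef_mul_eq_integral {ν : Measure ℝ} [IsFiniteMeasure ν] {E : ℂ[X]}
    (hE : E.degree = n) (hD : D.degree ≤ n) {σ κ : ℂ} (hκ : κ ≠ 0)
    (hexp : ∀ᵐ (y : ℝ) ∂ν, ‖exp (-(σ * y) * w)‖ ≤ 1)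
    (hi : Integrable (fun y : ℝ => 1 / E.eval (σ * (y : ℂ))) ν)
    (heq : κ * (∫ y, (D.eval (σ * (y : ℂ)) * exp (-(σ * y) * w) + coefSum c (σ * y)) /
      E.eval (σ * (y : ℂ)) ∂ν) = coefSum c σ) :
    (∀ k : Fin (n + 1),
      Integrable (fun y : ℝ => (σ * (y : ℂ)) ^ (k : ℕ) / E.eval (σ * (y : ℂ))) ν) ∧
    Integrable (fun y : ℝ => D.eval (σ * (y : ℂ)) * exp (-(σ * y) * w) / E.eval (σ * (y : ℂ))) ν ∧
    ∑ k : Fin (n + 1), (σ ^ (k : ℕ) / κ -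
        ∫ y, (σ * (y : ℂ)) ^ (k : ℕ) / E.eval (σ * (y : ℂ)) ∂ν) * c k =
      ∫ y, D.eval (σ * (y : ℂ)) * exp (-(σ * y) * w) / E.eval (σ * (y : ℂ)) ∂ν := by
  have hm : Measurable fun y : ℝ => σ * (y : ℂ) := by fun_prop
  have hk : ∀ k : Fin (n + 1),
      Integrable (fun y : ℝ => (σ * (y : ℂ)) ^ (k : ℕ) / E.eval (σ * (y : ℂ))) ν := fun k => by
    have hdeg : (X ^ (k : ℕ) : ℂ[X]).degree ≤ E.degree := by
      rw [degree_X_pow, hE]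
      exact_mod_cast Nat.lt_succ_iff.mp k.2
    simpa using integrable_eval_div_eval hdeg hm hi
  have hDi : Integrable
      (fun y : ℝ => D.eval (σ * (y : ℂ)) * exp (-(σ * y) * w) / E.eval (σ * (y : ℂ))) ν := by
    have h1 := (integrable_eval_div_eval (hD.trans hE.ge) hm hi).mul_bdd (c := 1)
      (g := fun y : ℝ => exp (-(σ * y) * w)) (by fun_prop) hexp
    refine h1.congr (ae_of_all _ fun y => ?_)
    simp only
    ring
  refine ⟨hk, hDi, ?_⟩
  have hsum : ∫ y, (D.eval (σ * (y : ℂ)) * exp (-(σ * y) * w) + coefSum c (σ * y)) /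
      E.eval (σ * (y : ℂ)) ∂ν =
      (∫ y, D.eval (σ * (y : ℂ)) * exp (-(σ * y) * w) / E.eval (σ * (y : ℂ)) ∂ν) +
        ∑ k : Fin (n + 1), (∫ y, (σ * (y : ℂ)) ^ (k : ℕ) / E.eval (σ * (y : ℂ)) ∂ν) * c k := by
    have h2 : ∀ k : Fin (n + 1), Integrable
        (fun y : ℝ => (σ * (y : ℂ)) ^ (k : ℕ) / E.eval (σ * (y : ℂ)) * c k) ν :=
      fun k => (hk k).mul_const _
    simp_rw [← integral_mul_const]
    rw [← integral_finsetSum _ fun k _ => h2 k, ← integral_add hDi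
      (integrable_finsetSum _ fun k _ => h2 k)]
    congr 1
    ext y
    rw [add_div, coefSum, Finset.sum_div]
    congr 1
    exact Finset.sum_congr rfl fun k _ => by ring
  rw [hsum] at heq
  have e : ∑ k : Fin (n + 1), (σ ^ (k : ℕ) / κ -
        ∫ y, (σ * (y : ℂ)) ^ (k : ℕ) / E.eval (σ * (y : ℂ)) ∂ν) * c k =
      coefSum c σ / κ -
        ∑ k : Fin (n + 1), (∫ y, (σ * (y : ℂ)) ^ (k : ℕ) / E.eval (σ * (y : ℂ)) ∂ν) * c k := by
    rw [coefSum, Finset.sum_div, ← Finset.sum_sub_distrib]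
    exact Finset.sum_congr rfl fun k _ => by ring
  rw [e, ← heq, mul_div_cancel_left₀ _ hκ]
  ring

end AtomOne

section AtomNeOne

variable {D N : ℂ[X]} {n : ℕ} {c : Fin (n + 1) → ℂ} {a q w : ℝ} {U : ℂ → ℂ}

/-- Dividing by D gives U(ζ) = e^{-ζw} + P(ζ)/D(ζ) + qΦ(ζ) U(aζ). Each iteration adds one term of
the series and moves the remainder one step along the orbit. -/
theorem sum_seriesTerm_add
    (hfun : ∀ z : ℂ, 0 ≤ z.re →
      D.eval z * (U z - exp (-z * w)) - q * N.eval z * U (a * z) = coefSum c z)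
    (ha0 : 0 < a) {z : ℂ} (hz : 0 ≤ z.re) (hDz : ∀ h : ℕ, D.eval ((a : ℂ) ^ h * z) ≠ 0) (H : ℕ) :
    ∑ h ∈ Finset.range H, seriesTerm D N a w q c z h +
      (q : ℂ) ^ H * prodPhi D N a z H * U ((a : ℂ) ^ H * z) = U z := by
  induction H with
  | zero => simp [prodPhi]
  | succ H ih =>
    have hre : 0 ≤ ((a : ℂ) ^ H * z).re := by
      rw [← ofReal_pow, re_ofReal_mul]; positivity
    have h1 := hfun _ hre
    have h2 := hDz H
    have h3 : (a : ℂ) ^ (H + 1) * z = a * ((a : ℂ) ^ H * z) := by ring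
    rw [← ih, Finset.sum_range_succ, prodPhi_succ, seriesTerm, h3]
    generalize (a : ℂ) ^ H * z = ζ at h1 h2 ⊢
    have h4 : U ζ = exp (-ζ * w) + coefSum c ζ / D.eval ζ +
        q * (N.eval ζ / D.eval ζ) * U (a * ζ) := by
      rw [div_eq_mul_inv, div_eq_mul_inv]
      linear_combination (D.eval ζ)⁻¹ * h1 -
        (U ζ - exp (-ζ * w)) * inv_mul_cancel₀ h2
    rw [h4]
    ring

/-- Iteration of the functional equation gives a convergent series. -/
theorem hasSum_seriesTerm
    (hfun : ∀ z : ℂ, 0 ≤ z.re →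
      D.eval z * (U z - exp (-z * w)) - q * N.eval z * U (a * z) = coefSum c z)
    {K : ℝ} (hU : ∀ z : ℂ, 0 ≤ z.re → ‖U z‖ ≤ K) (hw : 0 ≤ w)
    (ha0 : 0 < a) (ha1 : a ≠ 1) (hq0 : 0 ≤ q) (hq1 : q < 1)
    (hDN : D.eval 0 = N.eval 0) (hdeg : N.degree < D.degree) (hDn : D.degree = n)
    {z : ℂ} (hz : 0 ≤ z.re) (hDz : ∀ h : ℕ, D.eval ((a : ℂ) ^ h * z) ≠ 0)
    (hD0 : D.eval 0 ≠ 0) :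
    HasSum (seriesTerm D N a w q c z) (U z) := by
  have hS := summable_norm_pow_mul_prodPhi ha0 ha1 hq0 hq1 hD0 hDN hdeg z
  have hre : ∀ h : ℕ, 0 ≤ ((a : ℂ) ^ h * z).re := fun h => by
    rw [← ofReal_pow, re_ofReal_mul]; positivity
  obtain ⟨C, hC⟩ := exists_bound_eval_div_eval_pow ha0 ha1 hD0
    ((degree_coefPoly_le c).trans hDn.ge) z
  have hsum : Summable (seriesTerm D N a w q c z) := by
    refine (hS.mul_left (1 + C)).of_norm_bounded fun h => ?_
    rw [seriesTerm, mul_assoc, norm_mul]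
    gcongr
    refine (norm_add_le _ _).trans (add_le_add (norm_exp_neg_mul_ofReal_le_one
      (mul_nonneg (hre h) hw)) ?_)
    rw [← eval_coefPoly]
    exact hC h
  -- U is bounded on the half-plane, and its coefficient tends to 0 as the term of a summable
  -- series.
  have hrem : Tendsto (fun H : ℕ => (q : ℂ) ^ H * prodPhi D N a z H * U ((a : ℂ) ^ H * z)) atTop
      (𝓝 0) := by
    have h1 := hS.tendsto_atTop_zero.mul_const K
    rw [zero_mul] at h1
    refine squeeze_zero_norm (fun H => ?_) h1
    rw [norm_mul]
    gcongr
    exact hU _ (hre H)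
  have hlim := hsum.hasSum.tendsto_sum_nat.add hrem
  simp_rw [sum_seriesTerm_add hfun ha0 hz hDz] at hlim
  rw [add_zero] at hlim
  rw [tendsto_nhds_unique tendsto_const_nhds hlim]
  exact hsum.hasSum

/-- The equation at a zero `-τ` of the denominator in the right half-plane, split according to the
coefficients. -/
theorem sum_coef_mul_eq_tsum (hw : 0 ≤ w) (ha0 : 0 < a) (ha1 : a ≠ 1) (hq0 : 0 ≤ q) (hq1 : q < 1)
    (hD0 : D.eval 0 ≠ 0) (hDN : D.eval 0 = N.eval 0) (hdeg : N.degree < D.degree)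
    (hDn : D.degree = n) {τ : ℂ} (hτ : τ.re < 0) {u κ : ℂ}
    (hu : HasSum (seriesTerm D N a w q c (-((a : ℂ) * τ))) u)
    (heq : -κ * u = coefSum c (-τ)) :
    (∀ k : Fin (n + 1), Summable fun h : ℕ =>
      (a : ℂ) ^ ((k : ℕ) * (h + 1)) * (q : ℂ) ^ h * prodPhi D N a (-((a : ℂ) * τ)) h /
        D.eval (-((a : ℂ) ^ (h + 1) * τ))) ∧
    (Summable fun h : ℕ => exp ((a : ℂ) ^ (h + 1) * τ * w) * (q : ℂ) ^ h *
      prodPhi D N a (-((a : ℂ) * τ)) h) ∧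
    ∑ k : Fin (n + 1), (-τ) ^ (k : ℕ) * c k *
        (1 + κ * ∑' h : ℕ,
          (a : ℂ) ^ ((k : ℕ) * (h + 1)) * (q : ℂ) ^ h *
            prodPhi D N a (-((a : ℂ) * τ)) h / D.eval (-((a : ℂ) ^ (h + 1) * τ))) =
      -κ * ∑' h : ℕ, exp ((a : ℂ) ^ (h + 1) * τ * w) * (q : ℂ) ^ h *
        prodPhi D N a (-((a : ℂ) * τ)) h := by
  have hτ0 : τ ≠ 0 := by rintro rfl; simp at hτ
  have hS := summable_norm_pow_mul_prodPhi ha0 ha1 hq0 hq1 hD0 hDN hdeg (-((a : ℂ) * τ))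
  have hz : ∀ h : ℕ, (a : ℂ) ^ h * -((a : ℂ) * τ) = -((a : ℂ) ^ (h + 1) * τ) := fun h => by ring
  have hk : ∀ k : Fin (n + 1), Summable fun h : ℕ =>
      (a : ℂ) ^ ((k : ℕ) * (h + 1)) * (q : ℂ) ^ h * prodPhi D N a (-((a : ℂ) * τ)) h /
        D.eval (-((a : ℂ) ^ (h + 1) * τ)) := fun k => by
    have hXk : (X ^ (k : ℕ) : ℂ[X]).degree ≤ D.degree := by
      rw [degree_X_pow, hDn]
      exact_mod_cast Nat.lt_succ_iff.mp k.2
    obtain ⟨C, hC⟩ := exists_bound_eval_div_eval_pow ha0 ha1 hD0 hXk (-((a : ℂ) * τ))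
    have h1 : Summable fun h : ℕ => ((X ^ (k : ℕ) : ℂ[X]).eval ((a : ℂ) ^ h * -((a : ℂ) * τ)) /
        D.eval ((a : ℂ) ^ h * -((a : ℂ) * τ))) *
          ((q : ℂ) ^ h * prodPhi D N a (-((a : ℂ) * τ)) h) := by
      refine (hS.mul_left C).of_norm_bounded fun h => ?_
      rw [norm_mul]
      exact mul_le_mul_of_nonneg_right (hC h) (norm_nonneg _)
    -- The powers along the orbit of -aτ equal (-τ)^k a^{k(h+1)}; the constant (-τ)^k, nonzero as Re
    -- τ < 0, is removed.
    refine (h1.mul_left (((-τ) ^ (k : ℕ))⁻¹)).congr fun h => ?_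
    rw [hz, eval_pow, eval_X, ← mul_neg, mul_pow, ← pow_mul, mul_comm (h + 1) (k : ℕ)]
    have : (-τ) ^ (k : ℕ) ≠ 0 := pow_ne_zero _ (neg_ne_zero.mpr hτ0)
    field_simp
  have he : Summable fun h : ℕ => exp ((a : ℂ) ^ (h + 1) * τ * w) * (q : ℂ) ^ h *
      prodPhi D N a (-((a : ℂ) * τ)) h := by
    refine hS.of_norm_bounded fun h => ?_
    rw [mul_assoc, norm_mul]
    refine mul_le_of_le_one_left (norm_nonneg _) ?_
    have := norm_exp_neg_mul_ofReal_le_one (z := -((a : ℂ) ^ (h + 1) * τ)) (x := w) (by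
      rw [← mul_neg, ← ofReal_pow, re_ofReal_mul, neg_re]
      have := neg_nonneg.mpr hτ.le
      positivity)
    rwa [neg_neg] at this
  refine ⟨hk, he, ?_⟩
  have hs := he.hasSum.add (hasSum_sum fun k (_ : k ∈ (Finset.univ : Finset (Fin (n + 1)))) =>
    (hk k).hasSum.mul_left ((-τ) ^ (k : ℕ) * c k))
  have hu' := hu.unique (hs.congr_fun fun h => by
    rw [seriesTerm, hz, coefSum, neg_neg, add_mul, add_mul, Finset.sum_div, Finset.sum_mul,
      Finset.sum_mul]
    congr 1
    refine Finset.sum_congr rfl fun k _ => ?_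
    rw [← mul_neg, mul_pow, ← pow_mul, mul_comm (h + 1) (k : ℕ)]
    ring)
  have e : ∀ T : Fin (n + 1) → ℂ, ∑ k : Fin (n + 1), (-τ) ^ (k : ℕ) * c k * (1 + κ * T k) =
      coefSum c (-τ) + κ * ∑ k : Fin (n + 1), (-τ) ^ (k : ℕ) * c k * T k := fun T => by
    rw [coefSum, Finset.mul_sum, ← Finset.sum_add_distrib]
    exact Finset.sum_congr rfl fun k _ => by ring
  rw [e, ← heq, hu']
  ring

/-- The equation at a zero `σ` of the denominator in the left half-plane, split according to the
coefficients. -/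
theorem sum_coef_mul_eq_tsum_integral {ν : Measure ℝ} (hDn : D.natDegree = n) {σ κ : ℂ}
    (hexp : ∀ᵐ (y : ℝ) ∂ν, ∀ h : ℕ, ‖exp (-((a : ℂ) ^ h * (σ * y)) * w)‖ ≤ 1)
    (hDy : ∀ᵐ (y : ℝ) ∂ν, ∀ h : ℕ, D.eval ((a : ℂ) ^ h * (σ * (y : ℂ))) ≠ 0)
    (hconv : ∀ k : Fin (n + 1), AbsConvergent ν fun h y =>
      (q : ℂ) ^ h * (((a : ℂ) ^ h * y) ^ (k : ℕ) * prodPhi D N a (σ * y) h /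
        D.eval ((a : ℂ) ^ h * (σ * (y : ℂ)))))
    (heq : κ * (∫ y, ∑' h : ℕ, seriesTerm D N a w q c (σ * (y : ℂ)) h ∂ν) = coefSum c σ) :
    (AbsConvergent ν fun h y =>
      (q : ℂ) ^ h * (exp (-((a : ℂ) ^ h * (σ * y)) * w) * prodPhi D N a (σ * y) h)) ∧
    ∑ k : Fin (n + 1),
        σ ^ (k : ℕ) * (1 - κ * ∑' h : ℕ, (q : ℂ) ^ h *
          ∫ y, ((a : ℂ) ^ h * y) ^ (k : ℕ) * prodPhi D N a (σ * y) h /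
            D.eval ((a : ℂ) ^ h * (σ * (y : ℂ))) ∂ν) * c k =
      κ * ∑' h : ℕ, (q : ℂ) ^ h *
        ∫ y, exp (-((a : ℂ) ^ h * (σ * y)) * w) * prodPhi D N a (σ * y) h ∂ν := by
  set f : Fin (n + 1) → ℕ → ℝ → ℂ := fun k h y =>
    (q : ℂ) ^ h * (((a : ℂ) ^ h * y) ^ (k : ℕ) * prodPhi D N a (σ * y) h /
      D.eval ((a : ℂ) ^ h * (σ * (y : ℂ)))) with hf
  set F : ℕ → ℝ → ℂ := fun h y =>
    (q : ℂ) ^ h * (exp (-((a : ℂ) ^ h * (σ * y)) * w) * prodPhi D N a (σ * y) h) with hF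
  -- Writing 1 = Σ D.coeff k · z^k / D(z) makes the exponential terms linear combinations of the `f
  -- k h` times factors of modulus at most 1. Hence absolute convergence of the series in the d_k
  -- implies that of the right-hand side.
  have hFf : ∀ h, (fun y : ℝ => (∑ k : Fin (n + 1), D.coeff k * σ ^ (k : ℕ) * f k h y) *
      exp (-((a : ℂ) ^ h * (σ * y)) * w)) =ᵐ[ν] F h := fun h => by
    filter_upwards [hDy] with y hy
    have h1 : ∑ k : Fin (n + 1), D.coeff k * σ ^ (k : ℕ) * f k h y =
        (q : ℂ) ^ h * prodPhi D N a (σ * y) h := by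
      have h2 := eval_eq_sum_fin hDn.le ((a : ℂ) ^ h * (σ * (y : ℂ)))
      have h3 := hy h
      have h4 : ∑ k : Fin (n + 1), D.coeff k * σ ^ (k : ℕ) * f k h y =
          D.eval ((a : ℂ) ^ h * (σ * (y : ℂ))) * ((q : ℂ) ^ h * prodPhi D N a (σ * y) h /
            D.eval ((a : ℂ) ^ h * (σ * (y : ℂ)))) := by
        conv_rhs => rw [h2, Finset.sum_mul]
        rw [← h2]
        refine Finset.sum_congr rfl fun k _ => ?_
        simp only [hf]
        ring
      rw [h4, mul_div_cancel₀ _ h3]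
    rw [h1]
    simp only [hF]
    ring
  have hsumi : ∀ h, Integrable (fun y => ∑ k : Fin (n + 1), D.coeff k * σ ^ (k : ℕ) * f k h y) ν :=
    fun h => integrable_finsetSum _ fun k _ => ((hconv k).1 h).const_mul _
  have hexp' : ∀ h : ℕ, ∀ᵐ (y : ℝ) ∂ν, ‖exp (-((a : ℂ) ^ h * (σ * y)) * w)‖ ≤ 1 := fun h => by
    filter_upwards [hexp] with y hy using hy h
  have hFi : ∀ h, Integrable (F h) ν := fun h =>
    ((hsumi h).mul_bdd (by fun_prop) (hexp' h)).congr (hFf h)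
  have hFs : Summable fun h => ∫ y, ‖F h y‖ ∂ν := by
    refine (summable_sum fun k (_ : k ∈ (Finset.univ : Finset (Fin (n + 1)))) =>
      (hconv k).2.mul_left ‖D.coeff k * σ ^ (k : ℕ)‖).of_nonneg_of_le
      (fun h => integral_nonneg fun _ => norm_nonneg _) fun h => ?_
    have hi : ∀ k : Fin (n + 1), Integrable (fun y => ‖D.coeff k * σ ^ (k : ℕ)‖ * ‖f k h y‖) ν :=
      fun k => ((hconv k).1 h).norm.const_mul _
    simp_rw [← integral_const_mul]
    rw [← integral_finsetSum _ fun k _ => hi k]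
    refine integral_mono_ae (hFi h).norm (integrable_finsetSum _ fun k _ => hi k) ?_
    filter_upwards [hFf h, hexp' h] with y hy hy'
    rw [← hy, norm_mul]
    refine (mul_le_of_le_one_right (norm_nonneg _) hy').trans ((norm_sum_le _ _).trans ?_)
    exact Finset.sum_le_sum fun k _ => (norm_mul _ _).le
  refine ⟨⟨hFi, hFs⟩, ?_⟩
  have hFsum := hasSum_integral_of_summable_integral_norm hFi hFs
  have hfsum := fun k => hasSum_integral_of_summable_integral_norm (hconv k).1 (hconv k).2
  have hterm : ∀ (h : ℕ) (y : ℝ), seriesTerm D N a w q c (σ * (y : ℂ)) h =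
      F h y + ∑ k : Fin (n + 1), σ ^ (k : ℕ) * c k * f k h y := fun h y => by
    rw [seriesTerm, coefSum, add_mul, add_mul, Finset.sum_div, Finset.sum_mul, Finset.sum_mul]
    congr 1
    · simp only [hF]; ring
    · refine Finset.sum_congr rfl fun k _ => ?_
      simp only [hf]
      ring
  have hti : ∀ h, Integrable (fun y : ℝ => seriesTerm D N a w q c (σ * (y : ℂ)) h) ν := fun h => by
    simp_rw [hterm]
    exact (hFi h).add (integrable_finsetSum _ fun k _ => ((hconv k).1 h).const_mul _)
  have hts : Summable fun h => ∫ y : ℝ, ‖seriesTerm D N a w q c (σ * (y : ℂ)) h‖ ∂ν := by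
    have hi : ∀ h (k : Fin (n + 1)), Integrable (fun y => ‖σ ^ (k : ℕ) * c k‖ * ‖f k h y‖) ν :=
      fun h k => ((hconv k).1 h).norm.const_mul _
    refine (hFs.add (summable_sum fun k (_ : k ∈ (Finset.univ : Finset (Fin (n + 1)))) =>
      (hconv k).2.mul_left ‖σ ^ (k : ℕ) * c k‖)).of_nonneg_of_le
      (fun h => integral_nonneg fun _ => norm_nonneg _) fun h => ?_
    simp_rw [← integral_const_mul]
    rw [← integral_finsetSum _ fun k _ => hi h k, ← integral_add (hFi h).norm
      (integrable_finsetSum _ fun k _ => hi h k)]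
    refine integral_mono (hti h).norm
      ((hFi h).norm.add (integrable_finsetSum _ fun k _ => hi h k)) fun y => ?_
    simp only [hterm]
    refine (norm_add_le _ _).trans (add_le_add le_rfl ((norm_sum_le _ _).trans ?_))
    exact Finset.sum_le_sum fun k _ => (norm_mul _ _).le
  have htsum := hasSum_integral_of_summable_integral_norm hti hts
  have hall := htsum.unique ((hFsum.add (hasSum_sum fun k
    (_ : k ∈ (Finset.univ : Finset (Fin (n + 1)))) =>
      (hfsum k).mul_left (σ ^ (k : ℕ) * c k))).congr_fun fun h => by
    simp_rw [hterm]
    rw [integral_add (hFi h) (integrable_finsetSum _ fun k _ => ((hconv k).1 h).const_mul _),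
      integral_finsetSum _ fun k _ => ((hconv k).1 h).const_mul _]
    simp_rw [integral_const_mul])
  have eF : ∑' h : ℕ, (q : ℂ) ^ h *
      ∫ y, exp (-((a : ℂ) ^ h * (σ * y)) * w) * prodPhi D N a (σ * y) h ∂ν =
      ∫ y, ∑' h, F h y ∂ν := by
    rw [← hFsum.tsum_eq]
    simp only [hF, integral_const_mul]
  have ef : ∀ k : Fin (n + 1), ∑' h : ℕ, (q : ℂ) ^ h *
      ∫ y, ((a : ℂ) ^ h * y) ^ (k : ℕ) * prodPhi D N a (σ * y) h /
        D.eval ((a : ℂ) ^ h * (σ * (y : ℂ))) ∂ν = ∫ y, ∑' h, f k h y ∂ν := fun k => by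
    rw [← (hfsum k).tsum_eq]
    simp only [integral_const_mul]
  simp_rw [eF, ef]
  have e : ∀ T : Fin (n + 1) → ℂ, ∑ k : Fin (n + 1), σ ^ (k : ℕ) * (1 - κ * T k) * c k =
      coefSum c σ - κ * ∑ k : Fin (n + 1), σ ^ (k : ℕ) * c k * T k := fun T => by
    rw [coefSum, Finset.mul_sum, ← Finset.sum_sub_distrib]
    exact Finset.sum_congr rfl fun k _ => by ring
  rw [e, ← heq, hall]
  ring

end AtomNeOne

end CoefficientEquations

end ReflectedRecursion

/-! ### Assembly of the theorem -/

theorem theorem6 {Ω : Type*} [MeasurableSpace Ω] (μ : Measure Ω) [IsProbabilityMeasure μ]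
    (V A B : ℕ → Ω → ℝ)
    (hVm : ∀ i, Measurable (V i)) (hAm : ∀ i, Measurable (A i)) (hBm : ∀ i, Measurable (B i))
    -- the `V i` are i.i.d., the `Y i = B i - A i` are i.i.d., and the two sequences are independent
    (hVindep : iIndepFun V μ)
    (hYindep : iIndepFun (fun i ω => B i ω - A i ω) μ)
    (hVY : IndepFun (fun ω i => V i ω) (fun ω i => B i ω - A i ω) μ)
    (hAB : ∀ i, IndepFun (A i) (B i) μ)
    (hVid : ∀ i, IdentDistrib (V i) (V 0) μ μ)
    (hAid : ∀ i, IdentDistrib (A i) (A 0) μ μ)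
    (hBid : ∀ i, IdentDistrib (B i) (B 0) μ μ)
    (hA0 : ∀ i, ∀ᵐ ω ∂μ, 0 ≤ A i ω) (hB0 : ∀ i, ∀ᵐ ω ∂μ, 0 ≤ B i ω)
    -- `V = a` with probability `p`, and `V < 0` otherwise
    (a p w : ℝ) (ha : 0 < a) (hp0 : 0 < p) (hp1 : p < 1) (hw : 0 ≤ w)
    (hVa : μ.real {ω | V 0 ω = a} = p) (hVneg : μ.real {ω | V 0 ω < 0} = 1 - p)
    -- rational transforms of `B` and `A`
    {l m : ℕ} (s : Fin l → ℂ) (t : Fin m → ℂ) (NB NA : Polynomial ℂ)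
    (hs : ∀ j, (s j).re < 0) (ht : ∀ i, (t i).re < 0)
    (hB : HasRationalLST μ (B 0) s NB) (hA : HasRationalLST μ (A 0) t NA)
    (r : ℝ) (hr0 : 0 < r) (hr1 : r < 1) :
    let D : Polynomial ℂ := denY s t
    let N : Polynomial ℂ := numY NB NA
    let ν : Measure ℝ := negLaw μ (V 0)
    let q : ℝ := r * p
    let U : ℂ → ℂ := genLST μ (process V (fun i ω => B i ω - A i ω) w) r
    let E : Polynomial ℂ := D - Polynomial.C (q : ℂ) * N
    ∃ c : Fin (m + l + 1) → ℂ,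
      c 0 = (r : ℂ) / (1 - r) * (1 - p) * (-1) ^ (l + m) * (∏ j, s j) * (∏ i, t i) ∧
      -- the equations for the poles `s j`, in terms of `U`
      (∀ j, (r : ℂ) * (1 - p) * N.eval (s j) * (∫ y, U (s j * y) ∂ν) = coefSum c (s j)) ∧
      (a = 1 →
        (∀ z : ℂ, 0 ≤ z.re → E.eval z ≠ 0 →
          U z = (D.eval z * Complex.exp (-z * w) + coefSum c z) / E.eval z) ∧
        -- the `m` zeros in the open right half-plane, listed with multiplicity
        (∃ δ : Fin m → ℂ,
          E.roots.filter (fun z => 0 < z.re) = Finset.univ.val.map δ ∧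
          ∀ i, ∑ k : Fin (m + l + 1), δ i ^ (k : ℕ) * c k =
            -Complex.exp (-δ i * w) * D.eval (δ i)) ∧
        -- the equations for the poles `s j`, with the formula for `U` inserted
        (∀ j, (∀ᵐ (y : ℝ) ∂ν, E.eval (s j * (y : ℂ)) ≠ 0) →
          (r : ℂ) * (1 - p) * N.eval (s j) *
              (∫ y, (D.eval (s j * (y : ℂ)) * Complex.exp (-(s j * y) * w) +
                coefSum c (s j * y)) / E.eval (s j * (y : ℂ)) ∂ν) = coefSum c (s j)) ∧
        -- the same equations, split according to the coefficients
        (∀ j, (∀ᵐ (y : ℝ) ∂ν, E.eval (s j * (y : ℂ)) ≠ 0) →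
          Integrable (fun y : ℝ => 1 / E.eval (s j * (y : ℂ))) ν →
          N.eval (s j) ≠ 0 →
          (∀ k : Fin (m + l + 1),
            Integrable (fun y : ℝ => (s j * (y : ℂ)) ^ (k : ℕ) / E.eval (s j * (y : ℂ))) ν) ∧
          Integrable (fun y : ℝ => D.eval (s j * (y : ℂ)) * Complex.exp (-(s j * y) * w) /
            E.eval (s j * (y : ℂ))) ν ∧
          ∑ k : Fin (m + l + 1),
              (s j ^ (k : ℕ) / ((r : ℂ) * (1 - p) * N.eval (s j)) -
                ∫ y, (s j * (y : ℂ)) ^ (k : ℕ) / E.eval (s j * (y : ℂ)) ∂ν) * c k =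
            ∫ y, D.eval (s j * (y : ℂ)) * Complex.exp (-(s j * y) * w) /
              E.eval (s j * (y : ℂ)) ∂ν)) ∧
      (a ≠ 1 →
        (∀ z : ℂ, 0 ≤ z.re → (∀ h : ℕ, D.eval ((a : ℂ) ^ h * z) ≠ 0) →
          HasSum (seriesTerm D N a w q c z) (U z)) ∧
        -- the equations for the poles `t i`, in terms of `U`
        (∀ i, -(q : ℂ) * N.eval (-t i) * U (-((a : ℂ) * t i)) = coefSum c (-t i)) ∧
        -- the same equations, with the series for `U` inserted
        (∀ i, (∀ h : ℕ, D.eval (-((a : ℂ) ^ (h + 1) * t i)) ≠ 0) →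
          (∀ k : Fin (m + l + 1), Summable fun h : ℕ =>
            (a : ℂ) ^ ((k : ℕ) * (h + 1)) * (q : ℂ) ^ h * prodPhi D N a (-((a : ℂ) * t i)) h /
              D.eval (-((a : ℂ) ^ (h + 1) * t i))) ∧
          (Summable fun h : ℕ => Complex.exp ((a : ℂ) ^ (h + 1) * t i * w) * (q : ℂ) ^ h *
            prodPhi D N a (-((a : ℂ) * t i)) h) ∧
          ∑ k : Fin (m + l + 1), (-t i) ^ (k : ℕ) * c k *
              (1 + (q : ℂ) * N.eval (-t i) * ∑' h : ℕ,
                (a : ℂ) ^ ((k : ℕ) * (h + 1)) * (q : ℂ) ^ h *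
                  prodPhi D N a (-((a : ℂ) * t i)) h / D.eval (-((a : ℂ) ^ (h + 1) * t i))) =
            -(q : ℂ) * N.eval (-t i) * ∑' h : ℕ,
              Complex.exp ((a : ℂ) ^ (h + 1) * t i * w) * (q : ℂ) ^ h *
                prodPhi D N a (-((a : ℂ) * t i)) h) ∧
        -- the equations for the poles `s j`, with the series for `U` inserted
        (∀ j, (∀ᵐ (y : ℝ) ∂ν, ∀ h : ℕ, D.eval ((a : ℂ) ^ h * (s j * (y : ℂ))) ≠ 0) →
          (r : ℂ) * (1 - p) * N.eval (s j) *
              (∫ y, ∑' h : ℕ, seriesTerm D N a w q c (s j * (y : ℂ)) h ∂ν) = coefSum c (s j)) ∧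
        -- the same equations, split according to the coefficients
        (∀ j, (∀ᵐ (y : ℝ) ∂ν, ∀ h : ℕ, D.eval ((a : ℂ) ^ h * (s j * (y : ℂ))) ≠ 0) →
          (∀ k : Fin (m + l + 1), AbsConvergent ν fun h y =>
            (q : ℂ) ^ h * (((a : ℂ) ^ h * y) ^ (k : ℕ) * prodPhi D N a (s j * y) h /
              D.eval ((a : ℂ) ^ h * (s j * (y : ℂ))))) →
          (AbsConvergent ν fun h y =>
            (q : ℂ) ^ h * (Complex.exp (-((a : ℂ) ^ h * (s j * y)) * w) *
              prodPhi D N a (s j * y) h)) ∧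
          ∑ k : Fin (m + l + 1),
              s j ^ (k : ℕ) * (1 - (r : ℂ) * (1 - p) * N.eval (s j) * ∑' h : ℕ, (q : ℂ) ^ h *
                ∫ y, ((a : ℂ) ^ h * y) ^ (k : ℕ) * prodPhi D N a (s j * y) h /
                  D.eval ((a : ℂ) ^ h * (s j * (y : ℂ))) ∂ν) * c k =
            (r : ℂ) * (1 - p) * N.eval (s j) * ∑' h : ℕ, (q : ℂ) ^ h *
              ∫ y, Complex.exp (-((a : ℂ) ^ h * (s j * y)) * w) *
                prodPhi D N a (s j * y) h ∂ν)) := by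
  intro D N ν q U E
  have hDeg : D.natDegree = m + l := natDegree_denY s t
  have hDn0 : D ≠ 0 := denY_ne_zero s t
  have hDd : D.degree = ((m + l : ℕ) : WithBot ℕ) := by
    rw [Polynomial.degree_eq_natDegree hDn0, hDeg]
  have hND : N.degree < D.degree :=
    degree_numY_lt_degree_denY hB.degree_lt hA.degree_lt hB.num_ne_zero hA.num_ne_zero
  have hNdeg : N.natDegree ≤ m + l := by
    rw [← hDeg]; exact Polynomial.natDegree_le_natDegree hND.le
  have hYm : ∀ i, Measurable fun ω => B i ω - A i ω := fun i => (hBm i).sub (hAm i)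
  have hΦ : ∀ i (z : ℂ), z.re = 0 →
      D.eval z * lst μ (fun ω => B i ω - A i ω) z = N.eval z := fun i z hz =>
    eval_denY_mul_lst_sub (hAm i) (hBm i) (hAB i) hs ht
      (fun z hz => by rw [lst_congr_identDistrib (hBid i), hB.lst_eq z hz])
      (fun z hz => by rw [lst_congr_identDistrib (hAid i), hA.lst_eq z hz]) hz
  obtain ⟨c, hc0, hfun, hpole⟩ := exists_coefSum_genLST hVm hYm hVindep hYindep hVY hVid ha hp1 hw
    hVa hVneg hDeg.le hNdeg hΦ hr0 hr1
  have hneg0 : μ.real {ω | V 0 ω < 0} ≠ 0 := by rw [hVneg]; linarith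
  have hprob : IsProbabilityMeasure ν := isProbabilityMeasure_negLaw (hVm 0) hneg0
  have hyneg : ∀ᵐ y ∂ν, y < 0 := ae_negLaw_neg (hVm 0)
  have hq0 : 0 < q := mul_pos hr0 hp0
  have hq1 : q < 1 := by
    have : r * p < 1 * 1 := mul_lt_mul'' hr1 hp1 hr0.le hp0.le
    simpa [q] using this
  have hre : ∀ j (y : ℝ), y < 0 → 0 ≤ (s j * (y : ℂ)).re := fun j y hy => by
    rw [Complex.re_mul_ofReal]
    exact mul_nonneg_of_nonpos_of_nonpos (hs j).le hy.le
  have hDI : ∀ z : ℂ, z.re = 0 → D.eval z ≠ 0 := fun z hz => by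
    have hz' : 0 ≤ (-z).re := by simp [hz]
    simp only [D, denY, Polynomial.eval_mul, Polynomial.eval_comp, Polynomial.eval_neg,
      Polynomial.eval_X]
    exact mul_ne_zero (eval_poleDen_ne_zero hs hz.ge) (eval_poleDen_ne_zero ht hz')
  have hDN : D.eval 0 = N.eval 0 := by simpa [lst_zero] using hΦ 0 0 (by simp)
  have hEeval : ∀ z, E.eval z = D.eval z - q * N.eval z := fun z => by simp [E]
  have hpoleS : ∀ j, (r : ℂ) * (1 - p) * N.eval (s j) * (∫ y, U (s j * (y : ℂ)) ∂ν) =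
      coefSum c (s j) := fun j => hpole (s j) (hs j).le (eval_denY_left s t j)
  have hMd : (Polynomial.C (q : ℂ) * N).degree < D.degree :=
    (Polynomial.degree_C_mul_of_isUnit
      (IsUnit.mk0 _ (Complex.ofReal_ne_zero.mpr hq0.ne')) N).trans_lt hND
  refine ⟨c, ?_, hpoleS, fun ha1 => ?_, fun ha1 => ?_⟩
  · rw [hc0, eval_denY_zero]
    ring
  · subst ha1
    have hmain : ∀ z : ℂ, 0 ≤ z.re →
        E.eval z * U z = D.eval z * Complex.exp (-z * w) + coefSum c z := fun z hz => by
      have h := hfun z hz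
      rw [Complex.ofReal_one, one_mul] at h
      rw [hEeval]
      linear_combination h
    have hU : ∀ z : ℂ, 0 ≤ z.re → E.eval z ≠ 0 →
        U z = (D.eval z * Complex.exp (-z * w) + coefSum c z) / E.eval z := fun z hz hE =>
      eq_div_of_mul_eq hE (by rw [mul_comm]; exact hmain z hz)
    have hins : ∀ j, (∀ᵐ (y : ℝ) ∂ν, E.eval (s j * (y : ℂ)) ≠ 0) →
        (r : ℂ) * (1 - p) * N.eval (s j) *
          (∫ y, (D.eval (s j * (y : ℂ)) * Complex.exp (-(s j * y) * w) +
            coefSum c (s j * y)) / E.eval (s j * (y : ℂ)) ∂ν) = coefSum c (s j) := fun j hj => by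
      rw [← hpoleS j]
      congr 1
      refine integral_congr_ae ?_
      filter_upwards [hj, hyneg] with y hy hy'
      exact (hU _ (hre j y hy') hy).symm
    refine ⟨hU, ?_, hins, fun j hj hi hN => ?_⟩
    -- On the axis N = D Φ_Y with |Φ_Y| ≤ 1, being the transform of a real variable at an imaginary
    -- point, and q < 1: this is Rouché's condition.
    · have hlt : ∀ y : ℝ, ‖(Polynomial.C (q : ℂ) * N).eval (y * Complex.I)‖ <
          ‖D.eval (y * Complex.I)‖ := fun y => by
        have hz : (y * Complex.I : ℂ).re = 0 := by simp
        have h1 : ‖lst μ (fun ω => B 0 ω - A 0 ω) (y * Complex.I)‖ ≤ 1 :=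
          norm_lst_le (by simp) (ae_of_all _ fun ω => by rw [hz, zero_mul])
        have h2 : 0 < ‖D.eval (y * Complex.I)‖ := norm_pos_iff.mpr (hDI _ hz)
        rw [Polynomial.eval_mul, Polynomial.eval_C, ← hΦ 0 _ hz, norm_mul, norm_mul,
          Complex.norm_real, Real.norm_of_nonneg hq0.le]
        calc q * (‖D.eval (y * Complex.I)‖ * ‖lst μ (fun ω => B 0 ω - A 0 ω) (y * Complex.I)‖)
            ≤ q * (‖D.eval (y * Complex.I)‖ * 1) := by gcongr
          _ < 1 * (‖D.eval (y * Complex.I)‖ * 1) := by gcongr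
          _ = ‖D.eval (y * Complex.I)‖ := by ring
      have hcard : (E.roots.filter fun z => 0 < z.re).card = m := by
        rw [card_roots_sub_right_halfPlane hMd hlt]
        exact card_filter_roots_denY hs ht
      -- Any list representing the multiset of zeros serves as the enumeration δ; its length is m by
      -- the count.
      obtain ⟨L, hL⟩ := Quot.exists_rep (E.roots.filter fun z => 0 < z.re)
      have hLm : L.length = m := by rw [← hcard, ← hL]; rfl
      subst hLm
      have hδ : E.roots.filter (fun z => 0 < z.re) =
          (Finset.univ : Finset (Fin L.length)).val.map L.get := by
        rw [← hL, Fin.univ_val_map, List.ofFn_get]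
        rfl
      refine ⟨L.get, hδ, fun i => ?_⟩
      have hmem : L.get i ∈ E.roots.filter fun z => 0 < z.re := by
        rw [hδ]
        exact Multiset.mem_map_of_mem _ (Finset.mem_univ i)
      obtain ⟨h1, h2⟩ := Multiset.mem_filter.mp hmem
      have h3 := hmain (L.get i) h2.le
      have h4 : E.eval (L.get i) = 0 := (Polynomial.mem_roots'.mp h1).2
      rw [h4, zero_mul] at h3
      have h5 : ∑ k : Fin (L.length + l + 1), L.get i ^ (k : ℕ) * c k = coefSum c (L.get i) :=
        Finset.sum_congr rfl fun k _ => mul_comm _ _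
      rw [h5]
      linear_combination -h3
    · refine sum_coef_mul_eq_integral (D := D) (c := c) (w := w) (κ := r * (1 - p) * N.eval (s j))
        ((Polynomial.degree_sub_eq_left_of_degree_lt hMd).trans hDd) hDd.le ?_ ?_ hi (hins j hj)
      · refine mul_ne_zero (mul_ne_zero (Complex.ofReal_ne_zero.mpr hr0.ne') ?_) hN
        rw [sub_ne_zero]
        exact_mod_cast hp1.ne'
      · filter_upwards [hyneg] with y hy
        exact norm_exp_neg_mul_ofReal_le_one (mul_nonneg (hre j y hy) hw)
  · have hD0 : D.eval 0 ≠ 0 := hDI 0 (by simp)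
    have hser : ∀ z : ℂ, 0 ≤ z.re → (∀ h : ℕ, D.eval ((a : ℂ) ^ h * z) ≠ 0) →
        HasSum (seriesTerm D N a w q c z) (U z) := fun z hz hDz =>
      hasSum_seriesTerm hfun
        (fun z hz => norm_genLST_le (process_nonneg hw) hr0.le hr1 hz) hw ha ha1
        hq0.le hq1 hDN hND hDd hz hDz hD0
    have hpoleT : ∀ i, -(q : ℂ) * N.eval (-t i) * U (-((a : ℂ) * t i)) = coefSum c (-t i) :=
      fun i => by
        -- -t_i is a zero of D in the right half-plane, so only the term with U(-a t_i) survives.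
        have h := hfun (-t i) (by simpa using (ht i).le)
        have h0 : D.eval (-t i) = 0 := eval_denY_right s t i
        rw [h0, zero_mul, mul_neg] at h
        rw [← h]
        ring
    have hins : ∀ j, (∀ᵐ (y : ℝ) ∂ν, ∀ h : ℕ, D.eval ((a : ℂ) ^ h * (s j * (y : ℂ))) ≠ 0) →
        (r : ℂ) * (1 - p) * N.eval (s j) *
          (∫ y, ∑' h : ℕ, seriesTerm D N a w q c (s j * (y : ℂ)) h ∂ν) = coefSum c (s j) :=
      fun j hj => by
        rw [← hpoleS j]
        congr 1
        refine integral_congr_ae ?_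
        filter_upwards [hj, hyneg] with y hy hy'
        exact (hser _ (hre j y hy') hy).tsum_eq
    refine ⟨hser, hpoleT, fun i hi => ?_, hins, fun j hj hconv => ?_⟩
    · have hz : 0 ≤ (-((a : ℂ) * t i)).re := by
        rw [← mul_neg, Complex.re_ofReal_mul, Complex.neg_re]
        exact mul_nonneg ha.le (neg_nonneg.mpr (ht i).le)
      have hu := hser _ hz fun h => by
        have e : (a : ℂ) ^ h * -((a : ℂ) * t i) = -((a : ℂ) ^ (h + 1) * t i) := by ring
        rw [e]
        exact hi h
      have h := sum_coef_mul_eq_tsum hw ha ha1 hq0.le hq1 hD0 hDN hND hDd (ht i)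
        (κ := q * N.eval (-t i)) hu (by rw [← hpoleT i]; ring)
      rwa [← neg_mul (q : ℂ)] at h
    · refine sum_coef_mul_eq_tsum_integral hDeg ?_ hj hconv (hins j hj)
      filter_upwards [hyneg] with y hy h
      refine norm_exp_neg_mul_ofReal_le_one (mul_nonneg ?_ hw)
      rw [← Complex.ofReal_pow, Complex.re_ofReal_mul]
      exact mul_nonneg (pow_nonneg ha.le h) (hre j y hy)
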